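/- **Setting.** All manifolds are smooth and finite-dimensional. $G$ is a Lie group with Lie algebra $\mathfrak g$ (left-invariant vector fields), equipped with an invariant non-degenerate symmetric bilinear form $\langle\cdot,\cdot\rangle$, used to identify $\mathfrak g^*\cong\mathfrak g$; $e_i$, $e^i$ are dual bases. Let $\phi\in\wedge^3\mathfrak g$ be given by $\phi(\alpha,\beta,\gamma)=\frac12\alpha([\beta^\sharp,\gamma^\sharp])$, where $\beta^\sharp\in\mathfrak g$ denotes the element dual to $\beta\in\mathfrak g^*$. For a bivector field $\pi$ write $\pi(\alpha,\beta)=\beta(\pi^\sharp\alpha)$ and $\{f,g\}=\pi(df,dg)$, with the convention $(X\wedge Y)^\sharp\alpha=\alpha(Y)X-\alpha(X)Y$. A quasi-Poisson $\mathfrak g$-manifold $(N,\rho,\pi)$ is a manifold with a Lie algebra morphism $\rho:\mathfrak g\to\mathfrak X(N)$ and a bivector field $\pi$ with $[\pi,\rho(\xi)]=0$ for all $\xi\in\mathfrak g$ and $[\pi,\pi]=\rho(\phi)$, i.e. $2(\{f,\{g,h\}\}+\{g,\{h,f\}\}+\{h,\{f,g\}\})=\phi(\rho^*df,\rho^*dg,\rho^*dh)$.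 A quasi-Poisson (resp. anti-quasi-Poisson) map $F:(N,\rho,\pi)\to(N',\rho',\pi')$ is a smooth map with $F_*\circ\rho=\rho'$ and $F_*\pi=\pi'$ (resp. $F_*\pi=-\pi'$). A moment map is a smooth map $\Phi:N\to G$ with $d\Phi(\rho(\xi))=(\xi^L-\xi^R)\circ\Phi$ and $\pi^\sharp(\Phi^*\alpha)=\rho(\Phi^*b^*\alpha)$ for all $\alpha\in\Omega^1(G)$, where $b(\xi)=\frac12(\xi^L+\xi^R)$ and $\xi^L,\xi^R$ are the left- and right-invariant vector fields of $\xi$. **Groupoids.** In a Lie groupoid $\Gamma\rightrightarrows M$ with source $s$ and target $t$ the product $gh$ is defined if $s(g)=t(h)$; the base $M$ is Hausdorff and $\sigma$-compact. Its Lie algebroid $\mathrm{Lie}(\Gamma)$ is $\ker dt|_M$ with anchor $ds$ and the bracket of left-invariant vector fields. A Hamiltonian quasi-Poisson $\mathfrak g$-groupoid is a Lie groupoid $\Gamma\rightrightarrows M$ with a quasi-Poisson structure $(\rho_\Gamma,\pi_\Gamma)$ and a moment map $\Phi:\Gamma\to G$ such that $\Phi$ is a morphism of groupoids, $\mathfrak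 g$ acts by infinitesimal groupoid automorphisms, and the graph $\{(g,h,gh)\}\subset\Gamma^3$ is coisotropic for $\pi_1+\pi_2+\frac12\sum_i\rho_1(e^i)\wedge\rho_2(e_i)-\pi_3$, where the indices denote the factor of $\Gamma^3$ on which $\pi_\Gamma$, $\rho_\Gamma$ are placed. **Bialgebroids.** A quasi-Poisson $\mathfrak g$-bialgebroid $(A,\rho,\mathcal D)$ over $M$ is a Lie algebroid $A\to M$ with anchor $\mathbf a$, a Lie algebra morphism $\rho:\mathfrak g\to\mathbf\Gamma(A)$, and a degree $+1$ derivation $\mathcal D$ of the Gerstenhaber algebra $\mathbf\Gamma(\wedge A)$, with $\mathcal D\rho(\xi)=0$ and $\mathcal D^2=\frac12[\rho(\phi),\cdot]$. Then $A^*$ is a Lie algebroid with differential $d_{A^*}=\mathcal D+\frac12\sum_i\rho(e^i)\wedge[\rho(e_i),\cdot]$. **Correspondence.** $(\Gamma,\rho_\Gamma,\pi_\Gamma,\Phi)$ corresponds to $(A,\rho,\mathcal D)$ if there is given a vector bundle isomorphism $\kappa$ from $A$ onto the conormal bundle $\nu^*M\subset T^*\Gamma|_M$ of the units (so that $A^*\cong\ker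 dt|_M$) such that 1. $A^*\cong\mathrm{Lie}(\Gamma)$ as Lie algebroids; 2. $\Phi$ integrates $\mu_\rho:A^*\to\mathfrak g$, the map dual to $\rho$: $\langle \kappa(\rho(\xi)),v\rangle=\langle\xi,d\Phi(v)\rangle$ for vectors $v$ tangent to $\Gamma$ at units; 3. the Lie algebroid structure of $A\cong\nu^*M$ is the restriction of that of $T^*\Gamma$, whose anchor is $\pi_\Gamma^\sharp+\frac12\rho_\Gamma\circ\rho_\Gamma^*$ and whose bracket is $[df,dg]=d\{f,g\}+\frac12\sum_i\big(df(\rho_\Gamma(e^i))\,\mathcal L_{\rho_\Gamma(e_i)}dg-dg(\rho_\Gamma(e^i))\,\mathcal L_{\rho_\Gamma(e_i)}df\big)$. **Proposition.** Let $(\Gamma,\rho_\Gamma,\pi_\Gamma,\Phi)$ be a Hamiltonian quasi-Poisson $\mathfrak g$-groupoid over $M$ corresponding to the quasi-Poisson $\mathfrak g$-bialgebroid $(A,\rho,\mathcal D)$. Then there is a bivector field $\pi_{\mathcal D}$ on $M$ with $\pi_{\mathcal D}^\sharp(df)=\mathbf a(\mathcal Df)$ for all $f\in C^\infty(M)$,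 and $(M,\mathbf a\circ\rho,\pi_{\mathcal D})$ is a quasi-Poisson $\mathfrak g$-manifold. The source map $s:(\Gamma,\rho_\Gamma,\pi_\Gamma)\to(M,\mathbf a\circ\rho,\pi_{\mathcal D})$ is quasi-Poisson, and the target map $t:(\Gamma,\rho_\Gamma,\pi_\Gamma)\to(M,\mathbf a\circ\rho,\pi_{\mathcal D})$ is anti-quasi-Poisson. -/

import Mathlib

open scoped Manifold ContDiff Topology
namespace QP
section Algebra
variable {R S : Type*} [CommRing R] [AddCommGroup S] [Module R S]

/-- The abelian group `⋀S × ⋀S` with the multiplication `(a, b)(a', b') = (aa', ab' + bτ(a'))`, for an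
algebra endomorphism `τ`: a square-zero extension, used to construct twisted derivations. -/
def TwExt (τ : ExteriorAlgebra R S →ₐ[R] ExteriorAlgebra R S) : Type _ :=
  (fun _ => ExteriorAlgebra R S × ExteriorAlgebra R S) τ

noncomputable instance (τ : ExteriorAlgebra R S →ₐ[R] ExteriorAlgebra R S) :
    AddCommGroup (TwExt τ) :=
  inferInstanceAs (AddCommGroup (ExteriorAlgebra R S × ExteriorAlgebra R S))

/-- The element `(a, b)`. -/
def TwExt.mk (τ : ExteriorAlgebra R S →ₐ[R] ExteriorAlgebra R S) (a b : ExteriorAlgebra R S) :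
    TwExt τ := (a, b)

theorem TwExt.ext' {τ : ExteriorAlgebra R S →ₐ[R] ExteriorAlgebra R S} {x y : TwExt τ}
    (h₁ : x.1 = y.1) (h₂ : x.2 = y.2) : x = y := Prod.ext h₁ h₂

noncomputable instance (τ : ExteriorAlgebra R S →ₐ[R] ExteriorAlgebra R S) : Ring (TwExt τ) :=
  { (inferInstance : AddCommGroup (TwExt τ)) with
    mul := fun p q => (p.1 * q.1, p.1 * q.2 + p.2 * τ q.1)
    one := (1, 0)
    left_distrib := fun a b c => Prod.ext (mul_add a.1 b.1 c.1) <| by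
      show a.1 * (b.2 + c.2) + a.2 * τ (b.1 + c.1) =
        (a.1 * b.2 + a.2 * τ b.1) + (a.1 * c.2 + a.2 * τ c.1)
      rw [map_add, mul_add, mul_add]; abel
    right_distrib := fun a b c => Prod.ext (add_mul a.1 b.1 c.1) <| by
      show (a.1 + b.1) * c.2 + (a.2 + b.2) * τ c.1 =
        (a.1 * c.2 + a.2 * τ c.1) + (b.1 * c.2 + b.2 * τ c.1)
      rw [add_mul, add_mul]; abel
    zero_mul := fun a => Prod.ext (zero_mul a.1) <| by
      show 0 * a.2 + 0 * τ a.1 = 0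
      simp
    mul_zero := fun a => Prod.ext (mul_zero a.1) <| by
      show a.1 * 0 + a.2 * τ 0 = 0
      simp
    mul_assoc := fun a b c => Prod.ext (mul_assoc a.1 b.1 c.1) <| by
      show a.1 * b.1 * c.2 + (a.1 * b.2 + a.2 * τ b.1) * τ c.1 =
        a.1 * (b.1 * c.2 + b.2 * τ c.1) + a.2 * τ (b.1 * c.1)
      rw [map_mul]; simp only [mul_add, add_mul, mul_assoc]; abel
    one_mul := fun a => Prod.ext (one_mul a.1) <| by
      show 1 * a.2 + 0 * τ a.1 = a.2
      simp
    mul_one := fun a => Prod.ext (mul_one a.1) <| by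
      show a.1 * 0 + a.2 * τ 1 = a.2
      simp }

/-- Construction of `τ`-twisted derivations of the exterior algebra from their values on the
generators. -/
theorem exists_twistedDer (τ : ExteriorAlgebra R S →ₐ[R] ExteriorAlgebra R S)
    (δ₀ : R →+ ExteriorAlgebra R S) (δ₁ : S →+ ExteriorAlgebra R S)
    (h₀ : ∀ f g, δ₀ (f * g) = f • δ₀ g + g • δ₀ f)
    (hc : ∀ f P, δ₀ f * τ P = P * δ₀ f)
    (h₁ : ∀ (f : R) (X : S), δ₁ (f • X) = f • δ₁ X + δ₀ f * τ (ExteriorAlgebra.ι R X))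
    (hsq : ∀ X : S, ExteriorAlgebra.ι R X * δ₁ X + δ₁ X * τ (ExteriorAlgebra.ι R X) = 0) :
    ∃ δ : ExteriorAlgebra R S →+ ExteriorAlgebra R S,
      (∀ f : R, δ (algebraMap R _ f) = δ₀ f) ∧ (∀ X, δ (ExteriorAlgebra.ι R X) = δ₁ X) ∧
      ∀ P P', δ (P * P') = P * δ P' + δ P * τ P' := by
  have h01 : δ₀ 1 = 0 := by
    have := h₀ 1 1
    simpa using this
  let φ : R →+* TwExt τ :=
    { toFun := fun f => TwExt.mk τ (algebraMap R _ f) (δ₀ f)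
      map_one' := TwExt.ext' (map_one _) h01
      map_zero' := TwExt.ext' (map_zero _) (map_zero _)
      map_add' := fun f g => TwExt.ext' (map_add _ f g) (map_add _ f g)
      map_mul' := fun f g => TwExt.ext' (map_mul _ f g) <| by
        show δ₀ (f * g) = algebraMap R _ f * δ₀ g + δ₀ f * τ (algebraMap R _ g)
        rw [h₀, hc, Algebra.smul_def, Algebra.smul_def] }
  have hcomm : ∀ (f : R) (x : TwExt τ), φ f * x = x * φ f := fun f x =>
    TwExt.ext' (Algebra.commutes f x.1) <| by
      show algebraMap R _ f * x.2 + δ₀ f * τ x.1 = x.1 * δ₀ f + x.2 * τ (algebraMap R _ f)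
      rw [hc, AlgHom.commutes, Algebra.commutes f x.2, add_comm]
  let _ : Algebra R (TwExt τ) := φ.toAlgebra' hcomm
  have hsm : ∀ (f : R) (x : TwExt τ), f • x = φ f * x := fun f x => Algebra.smul_def f x
  let ψ : S →ₗ[R] TwExt τ :=
    { toFun := fun X => TwExt.mk τ (ExteriorAlgebra.ι R X) (δ₁ X)
      map_add' := fun X Y => TwExt.ext' (map_add _ X Y) (map_add _ X Y)
      map_smul' := fun f X => by
        rw [RingHom.id_apply, hsm]
        refine TwExt.ext' ?_ ?_
        · show ExteriorAlgebra.ι R (f • X) = algebraMap R _ f * ExteriorAlgebra.ι R X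
          rw [map_smul, Algebra.smul_def]
        · show δ₁ (f • X) = algebraMap R _ f * δ₁ X + δ₀ f * τ (ExteriorAlgebra.ι R X)
          rw [h₁, Algebra.smul_def] }
  let Ψ : ExteriorAlgebra R S →ₐ[R] TwExt τ := ExteriorAlgebra.lift R ⟨ψ, fun X =>
    TwExt.ext' (ExteriorAlgebra.ι_sq_zero X) (hsq X)⟩
  have hΨι : ∀ X, Ψ (ExteriorAlgebra.ι R X) = ψ X := fun X =>
    ExteriorAlgebra.lift_ι_apply R ψ _ X
  have hΨf : ∀ f : R, Ψ (algebraMap R _ f) = φ f := fun f => Ψ.commutes f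
  have hfst : ∀ P, (Ψ P).1 = P := by
    intro P
    induction P using ExteriorAlgebra.induction with
    | algebraMap f => rw [hΨf]; rfl
    | ι X => rw [hΨι]; rfl
    | mul a b ha hb =>
      rw [map_mul]
      show (Ψ a).1 * (Ψ b).1 = a * b
      rw [ha, hb]
    | add a b ha hb =>
      rw [map_add]
      show (Ψ a).1 + (Ψ b).1 = a + b
      rw [ha, hb]
  refine ⟨{ toFun := fun P => (Ψ P).2
            map_zero' := by rw [map_zero]; rfl
            map_add' := fun P Q => by rw [map_add]; rfl }, ?_, ?_, ?_⟩
  · intro f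
    show (Ψ (algebraMap R _ f)).2 = δ₀ f
    rw [hΨf]; rfl
  · intro X
    show (Ψ (ExteriorAlgebra.ι R X)).2 = δ₁ X
    rw [hΨι]; rfl
  · intro P P'
    show (Ψ (P * P')).2 = P * (Ψ P').2 + (Ψ P).2 * τ P'
    rw [map_mul]
    show (Ψ P).1 * (Ψ P').2 + (Ψ P).2 * τ (Ψ P').1 = _
    rw [hfst, hfst]

open ExteriorAlgebra in
theorem ι_mul_eq (X : S) (c : ExteriorAlgebra R S) :
    ι R X * c = CliffordAlgebra.involute c * ι R X := by
  induction c using CliffordAlgebra.left_induction with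
  | algebraMap r => rw [AlgHom.commutes]; exact (Algebra.commutes r _).symm
  | add x y hx hy => rw [mul_add, map_add, add_mul, hx, hy]
  | ι_mul x m hx =>
    have h : ι R X * ι R m = - (ι R m * ι R X) := by
      rw [eq_neg_iff_add_eq_zero]; exact ι_add_mul_swap X m
    change ι R X * (ι R m * x) = CliffordAlgebra.involute (CliffordAlgebra.ι _ m * x) * ι R X
    rw [map_mul, CliffordAlgebra.involute_ι, ← mul_assoc, h, neg_mul, mul_assoc, hx]
    change -(ι R m * (CliffordAlgebra.involute x * ι R X)) =
      -(ι R m) * CliffordAlgebra.involute x * ι R X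
    simp only [mul_assoc, neg_mul]

theorem comm_of_even {c : ExteriorAlgebra R S} (hc : CliffordAlgebra.involute c = c)
    (P : ExteriorAlgebra R S) : c * P = P * c := by
  induction P using ExteriorAlgebra.induction with
  | algebraMap f => exact (Algebra.commutes f c).symm
  | ι X => rw [ι_mul_eq, hc]
  | mul a b ha hb => rw [← mul_assoc, ha, mul_assoc, hb, mul_assoc]
  | add a b ha hb => rw [mul_add, add_mul, ha, hb]

theorem comm_of_odd {c : ExteriorAlgebra R S} (hc : CliffordAlgebra.involute c = -c)
    (P : ExteriorAlgebra R S) : c * CliffordAlgebra.involute P = P * c := by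
  induction P using ExteriorAlgebra.induction with
  | algebraMap f => rw [AlgHom.commutes]; exact (Algebra.commutes f c).symm
  | ι X =>
    rw [ι_mul_eq, hc]
    change c * CliffordAlgebra.involute (CliffordAlgebra.ι _ X) = _
    rw [CliffordAlgebra.involute_ι, neg_mul, mul_neg]
  | mul a b ha hb => rw [map_mul, ← mul_assoc, ha, mul_assoc, hb, mul_assoc]
  | add a b ha hb => rw [map_add, mul_add, add_mul, ha, hb]

theorem involute_contract (θ : Module.Dual R S) (Q : ExteriorAlgebra R S) :
    CliffordAlgebra.involute (CliffordAlgebra.contractLeft θ Q) =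
      - CliffordAlgebra.contractLeft θ (CliffordAlgebra.involute Q) := by
  induction Q using CliffordAlgebra.left_induction with
  | algebraMap r => simp
  | add x y hx hy => simp only [map_add, hx, hy]; abel
  | ι_mul x m hx =>
    rw [CliffordAlgebra.contractLeft_ι_mul]
    simp only [map_sub, map_smul, map_mul, CliffordAlgebra.involute_ι, hx, neg_mul, map_neg,
      CliffordAlgebra.contractLeft_ι_mul]
    simp only [mul_neg]; abel

variable [Algebra ℝ R]

/-- The even part of a multivector; `involute` is the parity involution `P ↦ (-1)^|P| P`. -/
noncomputable def evenPart (Q : ExteriorAlgebra R S) : ExteriorAlgebra R S :=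
  algebraMap ℝ R 2⁻¹ • (Q + CliffordAlgebra.involute Q)

/-- The odd part of a multivector. -/
noncomputable def oddPart (Q : ExteriorAlgebra R S) : ExteriorAlgebra R S :=
  algebraMap ℝ R 2⁻¹ • (Q - CliffordAlgebra.involute Q)

theorem half_add_half (Q : ExteriorAlgebra R S) : algebraMap ℝ R 2⁻¹ • (Q + Q) = Q := by
  rw [← two_smul R Q, smul_smul, ← map_ofNat (algebraMap ℝ R) 2, ← map_mul]
  norm_num

theorem evenPart_add_oddPart (Q : ExteriorAlgebra R S) : evenPart Q + oddPart Q = Q := by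
  rw [evenPart, oddPart, ← smul_add]
  conv_rhs => rw [← half_add_half Q]
  congr 1; abel

theorem involute_evenPart (Q : ExteriorAlgebra R S) :
    CliffordAlgebra.involute (evenPart Q) = evenPart Q := by
  rw [evenPart, map_smul, map_add, CliffordAlgebra.involute_involute, add_comm]

theorem involute_oddPart (Q : ExteriorAlgebra R S) :
    CliffordAlgebra.involute (oddPart Q) = - oddPart Q := by
  rw [oddPart, map_smul, map_sub, CliffordAlgebra.involute_involute, ← smul_neg, neg_sub]

theorem evenPart_eq {Q : ExteriorAlgebra R S} (h : CliffordAlgebra.involute Q = Q) :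
    evenPart Q = Q := by
  rw [evenPart, h, half_add_half]

theorem oddPart_of_even {Q : ExteriorAlgebra R S} (h : CliffordAlgebra.involute Q = Q) :
    oddPart Q = 0 := by
  rw [oddPart, h, sub_self, smul_zero]

theorem oddPart_eq {Q : ExteriorAlgebra R S} (h : CliffordAlgebra.involute Q = -Q) :
    oddPart Q = Q := by
  rw [oddPart, h, sub_neg_eq_add, half_add_half]

theorem evenPart_of_odd {Q : ExteriorAlgebra R S} (h : CliffordAlgebra.involute Q = -Q) :
    evenPart Q = 0 := by
  rw [evenPart, h, add_neg_cancel, smul_zero]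

end Algebra

/-- A Lie–Rinehart structure on an `R`-module `S` (algebraic form of a Lie algebroid: `R` is the
algebra of functions and `S` the module of sections). -/
structure LieRinehart (R S : Type*) [CommRing R] [Algebra ℝ R] [AddCommGroup S] [Module ℝ S]
    [Module R S] where
  anchor : S →ₗ[R] Derivation ℝ R R
  bracket : S →ₗ[ℝ] S →ₗ[ℝ] S
  bracket_self : ∀ X, bracket X X = 0
  jacobi : ∀ X Y Z,
    bracket X (bracket Y Z) = bracket (bracket X Y) Z + bracket Y (bracket X Z)
  leibniz : ∀ (X : S) (f : R) (Y : S), bracket X (f • Y) = f • bracket X Y + anchor X f • Y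

namespace LieRinehart
variable {R S : Type*} [CommRing R] [Algebra ℝ R] [AddCommGroup S] [Module ℝ S] [Module R S]
  (L : LieRinehart R S)

/-- The differential of a function, `(d f)(X) = anchor(X) f`. -/
def d (f : R) : Module.Dual R S where
  toFun X := L.anchor X f
  map_add' X Y := by rw [map_add]; rfl
  map_smul' g X := by rw [map_smul]; rfl

theorem bracket_swap (X Y : S) : L.bracket X Y = - L.bracket Y X := by
  have h := L.bracket_self (X + Y)
  simp only [map_add, LinearMap.add_apply, L.bracket_self, zero_add, add_zero] at h
  rw [eq_neg_iff_add_eq_zero, add_comm]; exact h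

theorem bracket_smul_left (f : R) (X Y : S) :
    L.bracket (f • X) Y = f • L.bracket X Y - L.anchor Y f • X := by
  rw [bracket_swap, leibniz, bracket_swap L Y X, smul_neg]; abel

open ExteriorAlgebra in
theorem exists_lieDer (X : S) : ∃ δ : ExteriorAlgebra R S →+ ExteriorAlgebra R S,
    (∀ f : R, δ (algebraMap R _ f) = algebraMap R _ (L.anchor X f)) ∧
    (∀ Y, δ (ι R Y) = ι R (L.bracket X Y)) ∧
    ∀ P P', δ (P * P') = P * δ P' + δ P * P' := by
  refine exists_twistedDer (AlgHom.id R _)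
    ((algebraMap R (ExteriorAlgebra R S)).toAddMonoidHom.comp
      (L.anchor X).toLinearMap.toAddMonoidHom)
    ((ι R (M := S)).toAddMonoidHom.comp (L.bracket X).toAddMonoidHom) ?_ ?_ ?_ ?_
  · intro f g
    change algebraMap R _ (L.anchor X (f * g)) =
      f • algebraMap R _ (L.anchor X g) + g • algebraMap R _ (L.anchor X f)
    rw [Derivation.leibniz, map_add, smul_eq_mul, smul_eq_mul, map_mul, map_mul, ← Algebra.smul_def,
      ← Algebra.smul_def]
  · intro f P
    exact Algebra.commutes (L.anchor X f) P
  · intro f Y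
    change ι R (L.bracket X (f • Y)) = f • ι R (L.bracket X Y) +
      algebraMap R _ (L.anchor X f) * ι R Y
    rw [L.leibniz, map_add, map_smul, map_smul, ← Algebra.smul_def]
  · intro Y
    exact ι_add_mul_swap Y (L.bracket X Y)

/-- The Lie derivative `L_X` of multisections: the derivation of degree `0` with
`L_X f = anchor(X) f` and `L_X Y = [X, Y]`. -/
noncomputable def lieDer (X : S) : ExteriorAlgebra R S →+ ExteriorAlgebra R S :=
  (L.exists_lieDer X).choose

theorem lieDer_fun (X : S) (f : R) :
    L.lieDer X (algebraMap R _ f) = algebraMap R _ (L.anchor X f) :=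
  (L.exists_lieDer X).choose_spec.1 f

theorem lieDer_ι (X Y : S) :
    L.lieDer X (ExteriorAlgebra.ι R Y) = ExteriorAlgebra.ι R (L.bracket X Y) :=
  (L.exists_lieDer X).choose_spec.2.1 Y

theorem lieDer_mul (X : S) (P P' : ExteriorAlgebra R S) :
    L.lieDer X (P * P') = P * L.lieDer X P' + L.lieDer X P * P' :=
  (L.exists_lieDer X).choose_spec.2.2 P P'

theorem lieDer_add_left (X Y : S) (Q : ExteriorAlgebra R S) :
    L.lieDer (X + Y) Q = L.lieDer X Q + L.lieDer Y Q := by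
  induction Q using ExteriorAlgebra.induction with
  | algebraMap f => simp only [lieDer_fun, map_add, Derivation.add_apply]
  | ι Z => simp only [lieDer_ι, map_add, LinearMap.add_apply]
  | mul a b ha hb => simp only [lieDer_mul, ha, hb]; simp only [mul_add, add_mul]; abel
  | add a b ha hb => simp only [map_add, ha, hb]; abel

theorem involute_lieDer (X : S) (Q : ExteriorAlgebra R S) :
    CliffordAlgebra.involute (L.lieDer X Q) = L.lieDer X (CliffordAlgebra.involute Q) := by
  induction Q using ExteriorAlgebra.induction with
  | algebraMap f => rw [lieDer_fun, AlgHom.commutes, AlgHom.commutes, lieDer_fun]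
  | ι Z =>
    rw [lieDer_ι]
    change CliffordAlgebra.involute (CliffordAlgebra.ι _ (L.bracket X Z)) =
      L.lieDer X (CliffordAlgebra.involute (CliffordAlgebra.ι _ Z))
    rw [CliffordAlgebra.involute_ι, CliffordAlgebra.involute_ι, map_neg]
    exact congrArg Neg.neg (L.lieDer_ι X Z).symm
  | mul a b ha hb => simp only [lieDer_mul, map_mul, map_add, ha, hb]
  | add a b ha hb => simp only [map_add, ha, hb]

open ExteriorAlgebra in
theorem lieDer_smul (f : R) (X : S) (Q : ExteriorAlgebra R S) :
    L.lieDer (f • X) Q =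
      f • L.lieDer X Q - ι R X * CliffordAlgebra.contractLeft (L.d f) Q := by
  induction Q using CliffordAlgebra.left_induction with
  | algebraMap r =>
    rw [CliffordAlgebra.contractLeft_algebraMap, mul_zero, sub_zero]
    have := L.lieDer_fun (f • X) r
    have h2 := L.lieDer_fun X r
    change L.lieDer (f • X) (algebraMap R (ExteriorAlgebra R S) r) =
      f • L.lieDer X (algebraMap R (ExteriorAlgebra R S) r)
    rw [this, h2, map_smul, Algebra.smul_def, ← map_mul]; rfl
  | add x y hx hy => simp only [map_add, hx, hy, smul_add, mul_add]; abel
  | ι_mul x m hx =>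
    have h : ι R X * ι R m = - (ι R m * ι R X) := by
      rw [eq_neg_iff_add_eq_zero]; exact ι_add_mul_swap X m
    rw [CliffordAlgebra.contractLeft_ι_mul]
    change L.lieDer (f • X) (ι R m * x) = f • L.lieDer X (ι R m * x) -
      ι R X * (L.anchor m f • x - ι R m * CliffordAlgebra.contractLeft (L.d f) x)
    have h' : ∀ y, ι R X * (ι R m * y) = - (ι R m * (ι R X * y)) := fun y => by
      rw [← mul_assoc, h, neg_mul, mul_assoc]
    rw [lieDer_mul, lieDer_mul, hx, lieDer_ι, lieDer_ι, bracket_smul_left, mul_sub, mul_sub, h',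
      map_sub, map_smul, map_smul, sub_mul, mul_smul_comm, mul_smul_comm,
      smul_mul_assoc, smul_mul_assoc, smul_add]
    abel


/-- `f ↦ [f, Q] = -ι_{df} Q`. -/
noncomputable def contractD (Q : ExteriorAlgebra R S) : R →+ ExteriorAlgebra R S where
  toFun f := - CliffordAlgebra.contractLeft (L.d f) Q
  map_zero' := by
    have : L.d 0 = 0 := LinearMap.ext fun X => map_zero (L.anchor X)
    rw [this, map_zero, LinearMap.zero_apply, neg_zero]
  map_add' f g := by
    have : L.d (f + g) = L.d f + L.d g := LinearMap.ext fun X => map_add (L.anchor X) f g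
    rw [this, map_add, LinearMap.add_apply, neg_add]

theorem contractD_apply (Q : ExteriorAlgebra R S) (f : R) :
    L.contractD Q f = - CliffordAlgebra.contractLeft (L.d f) Q := rfl

theorem contractD_mul (Q : ExteriorAlgebra R S) (f g : R) :
    L.contractD Q (f * g) = f • L.contractD Q g + g • L.contractD Q f := by
  have : L.d (f * g) = f • L.d g + g • L.d f :=
    LinearMap.ext fun X => (L.anchor X).leibniz f g
  simp only [contractD_apply]
  rw [this, map_add, map_smul, map_smul, LinearMap.add_apply, LinearMap.smul_apply,
    LinearMap.smul_apply, neg_add, smul_neg, smul_neg]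

/-- `X ↦ [X, Q] = L_X Q`. -/
noncomputable def lieDerHom (Q : ExteriorAlgebra R S) : S →+ ExteriorAlgebra R S where
  toFun X := L.lieDer X Q
  map_zero' := by
    have h := L.lieDer_add_left 0 0 Q
    rw [add_zero] at h
    exact left_eq_add.mp h
  map_add' X Y := L.lieDer_add_left X Y Q

open ExteriorAlgebra in
theorem exists_schouten_even (Q : ExteriorAlgebra R S) (hQ : CliffordAlgebra.involute Q = Q) :
    ∃ δ : ExteriorAlgebra R S →+ ExteriorAlgebra R S, (Q = 0 → δ = 0) ∧
      (∀ f : R, δ (algebraMap R _ f) = L.contractD Q f) ∧ (∀ X, δ (ι R X) = L.lieDer X Q) ∧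
      ∀ P P', δ (P * P') = P * δ P' + δ P * CliffordAlgebra.involute P' := by
  by_cases hQ0 : Q = 0
  · subst hQ0
    refine ⟨0, fun _ => rfl, fun f => ?_, fun X => ?_, fun P P' => ?_⟩
    · rw [contractD_apply, map_zero, neg_zero]; rfl
    · rw [map_zero]; rfl
    · simp
  have hodd : ∀ f, CliffordAlgebra.involute (L.contractD Q f) = - L.contractD Q f := fun f => by
    rw [contractD_apply, map_neg, involute_contract, hQ]
  obtain ⟨δ, h0, h1, h2⟩ := exists_twistedDer CliffordAlgebra.involute (L.contractD Q)
    (L.lieDerHom Q) (L.contractD_mul Q) (fun f P => comm_of_odd (hodd f) P)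
    (fun f X => by
      rw [comm_of_odd (hodd f)]
      change L.lieDer (f • X) Q = f • L.lieDer X Q +
        ι R X * - CliffordAlgebra.contractLeft (L.d f) Q
      rw [lieDer_smul, mul_neg, sub_eq_add_neg])
    (fun X => by
      change ι R X * L.lieDer X Q +
        L.lieDer X Q * CliffordAlgebra.involute (CliffordAlgebra.ι _ X) = 0
      have hL : CliffordAlgebra.involute (L.lieDer X Q) = L.lieDer X Q := by
        rw [involute_lieDer, hQ]
      rw [CliffordAlgebra.involute_ι, ι_mul_eq, hL]
      exact (congrArg _ (mul_neg _ _)).trans (add_neg_cancel _))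
  exact ⟨δ, fun h => (hQ0 h).elim, h0, h1, h2⟩

open ExteriorAlgebra in
theorem exists_schouten_odd (Q : ExteriorAlgebra R S) (hQ : CliffordAlgebra.involute Q = -Q) :
    ∃ δ : ExteriorAlgebra R S →+ ExteriorAlgebra R S, (Q = 0 → δ = 0) ∧
      (∀ f : R, δ (algebraMap R _ f) = L.contractD Q f) ∧ (∀ X, δ (ι R X) = L.lieDer X Q) ∧
      ∀ P P', δ (P * P') = P * δ P' + δ P * P' := by
  by_cases hQ0 : Q = 0
  · subst hQ0
    refine ⟨0, fun _ => rfl, fun f => ?_, fun X => ?_, fun P P' => ?_⟩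
    · rw [contractD_apply, map_zero, neg_zero]; rfl
    · rw [map_zero]; rfl
    · simp
  have hev : ∀ f, CliffordAlgebra.involute (L.contractD Q f) = L.contractD Q f := fun f => by
    rw [contractD_apply, map_neg, involute_contract, hQ, map_neg, neg_neg]
  obtain ⟨δ, h0, h1, h2⟩ := exists_twistedDer (AlgHom.id R _) (L.contractD Q)
    (L.lieDerHom Q) (L.contractD_mul Q) (fun f P => comm_of_even (hev f) P)
    (fun f X => by
      change L.lieDer (f • X) Q = f • L.lieDer X Q + L.contractD Q f * ι R X
      rw [comm_of_even (hev f), lieDer_smul, contractD_apply, mul_neg, sub_eq_add_neg])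
    (fun X => by
      change ι R X * L.lieDer X Q + L.lieDer X Q * ι R X = 0
      have hL : CliffordAlgebra.involute (L.lieDer X Q) = - L.lieDer X Q := by
        rw [involute_lieDer, hQ, map_neg]
      rw [ι_mul_eq, hL, neg_mul, neg_add_cancel])
  exact ⟨δ, fun h => (hQ0 h).elim, h0, h1, h2⟩

open ExteriorAlgebra in
theorem exists_schouten :
    ∃ br : ExteriorAlgebra R S → ExteriorAlgebra R S →+ ExteriorAlgebra R S,
      (∀ Q (f : R), br Q (algebraMap R _ f) = - CliffordAlgebra.contractLeft (L.d f) Q) ∧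
      (∀ Q X, br Q (ι R X) = L.lieDer X Q) ∧
      ∀ Q P P', br Q (P * P') = P * br Q P' + br (evenPart Q) P * CliffordAlgebra.involute P' +
        br (oddPart Q) P * P' := by
  choose! δe he0 hef heX hem using L.exists_schouten_even
  choose! δo ho0 hof hoX hom using L.exists_schouten_odd
  have e1 := fun Q : ExteriorAlgebra R S => involute_evenPart Q
  have o1 := fun Q : ExteriorAlgebra R S => involute_oddPart Q
  refine ⟨fun Q => δe (evenPart Q) + δo (oddPart Q), fun Q f => ?_, fun Q X => ?_,
    fun Q P P' => ?_⟩
  · rw [AddMonoidHom.add_apply, hef _ (e1 Q), hof _ (o1 Q), contractD_apply, contractD_apply,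
      ← neg_add, ← map_add, evenPart_add_oddPart]
  · rw [AddMonoidHom.add_apply, heX _ (e1 Q), hoX _ (o1 Q), ← map_add, evenPart_add_oddPart]
  · have z : CliffordAlgebra.involute (0 : ExteriorAlgebra R S) = 0 := map_zero _
    have z' : CliffordAlgebra.involute (0 : ExteriorAlgebra R S) = -0 := by rw [z, neg_zero]
    simp only [AddMonoidHom.add_apply, evenPart_eq (e1 Q), oddPart_of_even (e1 Q),
      oddPart_eq (o1 Q), evenPart_of_odd (o1 Q), he0 0 z rfl, ho0 0 z' rfl,
      hem _ (e1 Q), hom _ (o1 Q), AddMonoidHom.zero_apply, mul_add]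
    abel_nf

/-- The Schouten (Gerstenhaber) bracket `[P, Q]` on the exterior algebra, extending the anchor
and the bracket of sections: `[f, Q] = - ι_{df} Q`, `[X, Q] = L_X Q`, and
`[P ∧ P', Q] = P ∧ [P', Q] + (-1)^{|P'| (|Q| - 1)} [P, Q] ∧ P'`. These rules, proved below,
determine it. -/
noncomputable def schouten (P Q : ExteriorAlgebra R S) : ExteriorAlgebra R S :=
  L.exists_schouten.choose Q P

theorem schouten_fun (f : R) (Q : ExteriorAlgebra R S) :
    L.schouten (algebraMap R _ f) Q = - CliffordAlgebra.contractLeft (L.d f) Q :=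
  L.exists_schouten.choose_spec.1 Q f

theorem schouten_ι (X : S) (Q : ExteriorAlgebra R S) :
    L.schouten (ExteriorAlgebra.ι R X) Q = L.lieDer X Q :=
  L.exists_schouten.choose_spec.2.1 Q X

theorem schouten_mul (P P' Q : ExteriorAlgebra R S) :
    L.schouten (P * P') Q = P * L.schouten P' Q +
      L.schouten P (evenPart Q) * CliffordAlgebra.involute P' + L.schouten P (oddPart Q) * P' :=
  L.exists_schouten.choose_spec.2.2 Q P P'

theorem schouten_add (P P' Q : ExteriorAlgebra R S) :
    L.schouten (P + P') Q = L.schouten P Q + L.schouten P' Q :=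
  map_add (L.exists_schouten.choose Q) P P'

end LieRinehart

section Sections
variable {E : Type*} [NormedAddCommGroup E] [NormedSpace ℝ E]
  {M : Type*} [TopologicalSpace M] [ChartedSpace E M]
  {F : Type*} [NormedAddCommGroup F] [NormedSpace ℝ F]
  {A : M → Type*} [TopologicalSpace (Bundle.TotalSpace F A)] [∀ x, TopologicalSpace (A x)]
  [∀ x, AddCommGroup (A x)] [∀ x, Module ℝ (A x)] [FiberBundle F A] [VectorBundle ℝ F A]

/-- Smooth sections form a module over smooth functions. -/
noncomputable instance : Module C^∞⟮𝓘(ℝ, E), M; ℝ⟯ Cₛ^∞⟮𝓘(ℝ, E); F, A⟯ where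
  smul f X := ⟨fun x => f x • X x, f.contMDiff.smul_section X.contMDiff⟩
  one_smul X := ContMDiffSection.ext fun x => one_smul ℝ (X x)
  mul_smul f g X := ContMDiffSection.ext fun x => mul_smul (f x) (g x) (X x)
  smul_zero f := ContMDiffSection.ext fun x => smul_zero (f x)
  smul_add f X Y := ContMDiffSection.ext fun x => smul_add (f x) (X x) (Y x)
  add_smul f g X := ContMDiffSection.ext fun x => add_smul (f x) (g x) (X x)
  zero_smul X := ContMDiffSection.ext fun x => zero_smul ℝ (X x)

instance : IsScalarTower ℝ C^∞⟮𝓘(ℝ, E), M; ℝ⟯ Cₛ^∞⟮𝓘(ℝ, E); F, A⟯ where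
  smul_assoc c f X := ContMDiffSection.ext fun x => mul_smul c (f x) (X x)

end Sections


section Quadratic
variable {𝔤 : Type*} [LieRing 𝔤] [LieAlgebra ℝ 𝔤] [FiniteDimensional ℝ 𝔤]

/-- An invariant non-degenerate symmetric bilinear form on a Lie algebra, making it a quadratic
Lie algebra. -/
structure InvForm (𝔤 : Type*) [LieRing 𝔤] [LieAlgebra ℝ 𝔤] where
  form : LinearMap.BilinForm ℝ 𝔤
  symm : ∀ ξ η, form ξ η = form η ξ
  nondeg : form.Nondegenerate
  invariant : ∀ ξ η ζ, form ⁅ξ, η⁆ ζ = form ξ ⁅η, ζ⁆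

namespace InvForm

/-- The isomorphism `𝔤* → 𝔤` given by the form: `B (B.sharp α) ξ = α ξ`. -/
noncomputable def sharp (B : InvForm 𝔤) : (𝔤 →ₗ[ℝ] ℝ) ≃ₗ[ℝ] 𝔤 :=
  (B.form.toDual B.nondeg).symm

/-- A basis `e_i` of `𝔤`. -/
noncomputable def lo (_ : InvForm 𝔤) : Module.Basis (Fin (Module.finrank ℝ 𝔤)) ℝ 𝔤 :=
  Module.finBasis ℝ 𝔤

/-- The dual basis `e^i`, characterized by `B (e^i) (e_j) = δ_{ij}`. -/
noncomputable def up (B : InvForm 𝔤) : Module.Basis (Fin (Module.finrank ℝ 𝔤)) ℝ 𝔤 :=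
  B.form.dualBasis B.nondeg B.lo

/-- The invariant trivector, `φ(α, β, γ) = ½ α([s♯ β, s♯ γ])`. -/
noncomputable def phi (B : InvForm 𝔤) (α β γ : 𝔤 →ₗ[ℝ] ℝ) : ℝ :=
  2⁻¹ * α ⁅B.sharp β, B.sharp γ⁆

/-- The image in `⋀ S` of the trivector `φ ∈ ⋀³ 𝔤` under a linear map `ρ : 𝔤 → S`, namely
`(1/6) ∑ φ(ε_i, ε_j, ε_k) ρ(e_i) ∧ ρ(e_j) ∧ ρ(e_k)` with `ε_i` the coordinates of the basis. -/
noncomputable def phiImage {R S : Type*} [CommRing R] [Algebra ℝ R] [AddCommGroup S] [Module ℝ S]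
    [Module R S] (B : InvForm 𝔤) (ρ : 𝔤 →ₗ[ℝ] S) : ExteriorAlgebra R S :=
  ∑ i, ∑ j, ∑ k, algebraMap ℝ R (6⁻¹ * B.phi (B.lo.coord i) (B.lo.coord j) (B.lo.coord k)) •
    (ExteriorAlgebra.ι R (ρ (B.lo i)) * ExteriorAlgebra.ι R (ρ (B.lo j)) *
      ExteriorAlgebra.ι R (ρ (B.lo k)))

end InvForm
end Quadratic

section Manifolds
variable {n : ℕ} {N : Type*} [TopologicalSpace N] [ChartedSpace (EuclideanSpace ℝ (Fin n)) N]

/-- The differential at `x` of a real function on a manifold, as a covector. -/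
noncomputable def dfun (f : N → ℝ) (x : N) : TangentSpace (𝓡 n) x →L[ℝ] ℝ :=
  mfderiv (𝓡 n) 𝓘(ℝ, ℝ) f x

/-- Smoothness of a vector field. -/
def SmoothVF [IsManifold (𝓡 n) ∞ N] (X : ∀ x : N, TangentSpace (𝓡 n) x) : Prop :=
  ContMDiff (𝓡 n) (𝓡 n).tangent ∞ (fun x => (⟨x, X x⟩ : TangentBundle (𝓡 n) N))

/-- An action of a Lie algebra on a manifold: a Lie algebra morphism to the vector fields. -/
structure GAction (𝔤 : Type*) [LieRing 𝔤] [LieAlgebra ℝ 𝔤] (n : ℕ) (N : Type*)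
    [TopologicalSpace N] [ChartedSpace (EuclideanSpace ℝ (Fin n)) N]
    [IsManifold (𝓡 n) ∞ N] where
  act : ∀ x : N, 𝔤 →ₗ[ℝ] TangentSpace (𝓡 n) x
  smooth : ∀ ξ, SmoothVF (fun x => act x ξ)
  lie : ∀ ξ η x, act x ⁅ξ, η⁆ =
    VectorField.mlieBracket (𝓡 n) (fun y => act y ξ) (fun y => act y η) x

/-- A bivector field `π`, given by its sharp map `π♯ : T*N → TN`, with `π(α, β) = β(π♯ α)`.
The bivector `X ∧ Y` has sharp map `α ↦ α(Y) X - α(X) Y`. -/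
structure BivectorField (n : ℕ) (N : Type*)
    [TopologicalSpace N] [ChartedSpace (EuclideanSpace ℝ (Fin n)) N]
    [IsManifold (𝓡 n) ∞ N] where
  sharp : ∀ x : N, (TangentSpace (𝓡 n) x →L[ℝ] ℝ) →L[ℝ] TangentSpace (𝓡 n) x
  skew : ∀ x (α β : TangentSpace (𝓡 n) x →L[ℝ] ℝ), β (sharp x α) = - α (sharp x β)
  smooth : ContMDiff (𝓡 n) ((𝓡 n).prod 𝓘(ℝ, (EuclideanSpace ℝ (Fin n) →L[ℝ] ℝ) →L[ℝ]
      EuclideanSpace ℝ (Fin n))) ∞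
    (fun x ↦ Bundle.TotalSpace.mk' ((EuclideanSpace ℝ (Fin n) →L[ℝ] ℝ) →L[ℝ]
        EuclideanSpace ℝ (Fin n))
      (E := fun x : N => (TangentSpace (𝓡 n) x →L[ℝ] ℝ) →L[ℝ] TangentSpace (𝓡 n) x)
      x (sharp x))

variable [IsManifold (𝓡 n) ∞ N]

/-- The bracket `{f, g} = π(df, dg)` of functions. -/
noncomputable def BivectorField.poisson (π : BivectorField n N) (f g : N → ℝ) (x : N) : ℝ :=
  dfun g x (π.sharp x (dfun f x))

variable {𝔤 : Type*} [LieRing 𝔤] [LieAlgebra ℝ 𝔤] [FiniteDimensional ℝ 𝔤]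

/-- The derivative `ρ(ξ) f` of a function. -/
noncomputable def GAction.deriv (ρ : GAction 𝔤 n N) (ξ : 𝔤) (f : N → ℝ) (x : N) : ℝ :=
  dfun f x (ρ.act x ξ)

/-- The transpose `ρ* : T*N → 𝔤*`. -/
noncomputable def GAction.transpose (ρ : GAction 𝔤 n N) {x : N}
    (α : TangentSpace (𝓡 n) x →L[ℝ] ℝ) : 𝔤 →ₗ[ℝ] ℝ :=
  (α : TangentSpace (𝓡 n) x →ₗ[ℝ] ℝ) ∘ₗ ρ.act x

/-- `(N, ρ, π)` is a quasi-Poisson `𝔤`-manifold: `π` is `𝔤`-invariant and `[π, π] = ρ(φ)`. Both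
conditions are expressed by evaluation on (germs of) functions; `[π, π](df, dg, dh)` is twice the
Jacobiator of the bracket `{f, g} = π(df, dg)`. -/
structure IsQuasiPoisson (B : InvForm 𝔤) (ρ : GAction 𝔤 n N) (π : BivectorField n N) : Prop where
  invariant : ∀ (x : N) (f g : N → ℝ), ContMDiffAt (𝓡 n) 𝓘(ℝ, ℝ) ∞ f x →
    ContMDiffAt (𝓡 n) 𝓘(ℝ, ℝ) ∞ g x → ∀ ξ,
    ρ.deriv ξ (π.poisson f g) x = π.poisson (ρ.deriv ξ f) g x + π.poisson f (ρ.deriv ξ g) x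
  jacobi : ∀ (x : N) (f g h : N → ℝ), ContMDiffAt (𝓡 n) 𝓘(ℝ, ℝ) ∞ f x →
    ContMDiffAt (𝓡 n) 𝓘(ℝ, ℝ) ∞ g x → ContMDiffAt (𝓡 n) 𝓘(ℝ, ℝ) ∞ h x →
    2 * (π.poisson f (π.poisson g h) x + π.poisson g (π.poisson h f) x +
        π.poisson h (π.poisson f g) x) =
      B.phi (ρ.transpose (dfun f x)) (ρ.transpose (dfun g x)) (ρ.transpose (dfun h x))

variable {n' : ℕ} {N' : Type*} [TopologicalSpace N']
  [ChartedSpace (EuclideanSpace ℝ (Fin n')) N'] [IsManifold (𝓡 n') ∞ N']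

/-- A quasi-Poisson morphism: a smooth equivariant map sending `π` to `π'`. -/
structure IsQPMap (f : N → N') (ρ : GAction 𝔤 n N) (π : BivectorField n N)
    (ρ' : GAction 𝔤 n' N') (π' : BivectorField n' N') : Prop where
  smooth : ContMDiff (𝓡 n) (𝓡 n') ∞ f
  equivariant : ∀ x ξ, mfderiv (𝓡 n) (𝓡 n') f x (ρ.act x ξ) = ρ'.act (f x) ξ
  bivector : ∀ x (β : TangentSpace (𝓡 n') (f x) →L[ℝ] ℝ),
    mfderiv (𝓡 n) (𝓡 n') f x (π.sharp x (β.comp (mfderiv (𝓡 n) (𝓡 n') f x))) =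
      π'.sharp (f x) β

/-- An anti-quasi-Poisson map: a smooth equivariant map sending `π` to `-π'`. -/
structure IsAntiQPMap (f : N → N') (ρ : GAction 𝔤 n N) (π : BivectorField n N)
    (ρ' : GAction 𝔤 n' N') (π' : BivectorField n' N') : Prop where
  smooth : ContMDiff (𝓡 n) (𝓡 n') ∞ f
  equivariant : ∀ x ξ, mfderiv (𝓡 n) (𝓡 n') f x (ρ.act x ξ) = ρ'.act (f x) ξ
  bivector : ∀ x (β : TangentSpace (𝓡 n') (f x) →L[ℝ] ℝ),
    mfderiv (𝓡 n) (𝓡 n') f x (π.sharp x (β.comp (mfderiv (𝓡 n) (𝓡 n') f x))) =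
      - π'.sharp (f x) β

end Manifolds

section MomentMap

instance {k : ℕ} {G : Type*} [TopologicalSpace G] [ChartedSpace (EuclideanSpace ℝ (Fin k)) G]
    (g : G) : FiniteDimensional ℝ (TangentSpace (𝓡 k) g) :=
  inferInstanceAs (FiniteDimensional ℝ (EuclideanSpace ℝ (Fin k)))

instance : ENat.LEInfty (minSmoothness ℝ 3) := by
  rw [minSmoothness_of_isRCLikeNormedField]; infer_instance

variable {k : ℕ} {G : Type*} [TopologicalSpace G] [ChartedSpace (EuclideanSpace ℝ (Fin k)) G]
  [Group G] [LieGroup (𝓡 k) ∞ G]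
  {n : ℕ} {N : Type*} [TopologicalSpace N] [ChartedSpace (EuclideanSpace ℝ (Fin n)) N]
  [IsManifold (𝓡 n) ∞ N]

/-- The left-invariant vector field `ξ^L`. -/
noncomputable def leftVF (ξ : GroupLieAlgebra (𝓡 k) G) (g : G) : TangentSpace (𝓡 k) g :=
  mulInvariantVectorField ξ g

/-- The right-invariant vector field `ξ^R`. -/
noncomputable def rightVF (ξ : GroupLieAlgebra (𝓡 k) G) (g : G) : TangentSpace (𝓡 k) g :=
  mfderiv (𝓡 k) (𝓡 k) (fun a : G => a * g) 1 ξ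

/-- `Φ : N → G` is a moment map for the `𝔤`-action `ρ` and the bivector field `π`: it is smooth,
equivariant for `ξ ↦ ξ^L - ξ^R` on `G`, and `π♯(Φ*α) = ρ(Φ* b*α)` where
`b(ξ) = ½ (ξ^L + ξ^R)` and `𝔤* ≅ 𝔤` by the form. -/
structure IsMomentMap (B : InvForm (GroupLieAlgebra (𝓡 k) G))
    (ρ : GAction (GroupLieAlgebra (𝓡 k) G) n N) (π : BivectorField n N) (Φ : N → G) : Prop where
  smooth : ContMDiff (𝓡 n) (𝓡 k) ∞ Φ
  equivariant : ∀ x ξ, mfderiv (𝓡 n) (𝓡 k) Φ x (ρ.act x ξ) = leftVF ξ (Φ x) - rightVF ξ (Φ x)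
  moment : ∀ x (α : TangentSpace (𝓡 k) (Φ x) →L[ℝ] ℝ) (bα : GroupLieAlgebra (𝓡 k) G →ₗ[ℝ] ℝ),
    (∀ ξ, bα ξ = α ((2⁻¹ : ℝ) • (leftVF ξ (Φ x) + rightVF ξ (Φ x)))) →
    π.sharp x (α.comp (mfderiv (𝓡 n) (𝓡 k) Φ x)) = ρ.act x (B.sharp bα)

end MomentMap

section Groupoids

/-- A Lie groupoid `Γ ⇉ M` with source `s`, target `t`, unit `u`, inverse `inv`. The product
`mul g h` is meaningful when `s g = t h`. -/
structure LieGroupoid (n m : ℕ) (Γ M : Type*)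
    [TopologicalSpace Γ] [ChartedSpace (EuclideanSpace ℝ (Fin n)) Γ] [IsManifold (𝓡 n) ∞ Γ]
    [TopologicalSpace M] [ChartedSpace (EuclideanSpace ℝ (Fin m)) M] [IsManifold (𝓡 m) ∞ M] where
  s : Γ → M
  t : Γ → M
  u : M → Γ
  inv : Γ → Γ
  mul : Γ → Γ → Γ
  s_unit : ∀ x, s (u x) = x
  t_unit : ∀ x, t (u x) = x
  s_mul : ∀ g h, s g = t h → s (mul g h) = s h
  t_mul : ∀ g h, s g = t h → t (mul g h) = t g
  mul_assoc : ∀ g h l, s g = t h → s h = t l → mul (mul g h) l = mul g (mul h l)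
  unit_mul : ∀ g, mul (u (t g)) g = g
  mul_unit : ∀ g, mul g (u (s g)) = g
  s_inv : ∀ g, s (inv g) = t g
  t_inv : ∀ g, t (inv g) = s g
  inv_mul : ∀ g, mul (inv g) g = u (s g)
  mul_inv : ∀ g, mul g (inv g) = u (t g)
  smooth_s : ContMDiff (𝓡 n) (𝓡 m) ∞ s
  smooth_t : ContMDiff (𝓡 n) (𝓡 m) ∞ t
  smooth_u : ContMDiff (𝓡 m) (𝓡 n) ∞ u
  smooth_inv : ContMDiff (𝓡 n) (𝓡 n) ∞ inv
  submersion_s : ∀ g, Function.Surjective (mfderiv (𝓡 n) (𝓡 m) s g)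
  submersion_t : ∀ g, Function.Surjective (mfderiv (𝓡 n) (𝓡 m) t g)
  smooth_mul : ContMDiffOn ((𝓡 n).prod (𝓡 n)) (𝓡 n) ∞ (fun p : Γ × Γ => mul p.1 p.2)
    {p | s p.1 = t p.2}

variable {n m : ℕ} {Γ M : Type*}
    [TopologicalSpace Γ] [ChartedSpace (EuclideanSpace ℝ (Fin n)) Γ] [IsManifold (𝓡 n) ∞ Γ]
    [TopologicalSpace M] [ChartedSpace (EuclideanSpace ℝ (Fin m)) M] [IsManifold (𝓡 m) ∞ M]

namespace LieGroupoid

/-- `(v, w, z)` is tangent at `(g, h, gh)` to the graph of the multiplication: it is the velocity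
of a smooth curve `(c₁, c₂, c₁ c₂)` in the graph. -/
def TangentGraph (𝒢 : LieGroupoid n m Γ M) (g h : Γ) (v : TangentSpace (𝓡 n) g)
    (w : TangentSpace (𝓡 n) h) (z : TangentSpace (𝓡 n) (𝒢.mul g h)) : Prop :=
  ∃ c₁ c₂ : ℝ → Γ, ContMDiff 𝓘(ℝ, ℝ) (𝓡 n) ∞ c₁ ∧ ContMDiff 𝓘(ℝ, ℝ) (𝓡 n) ∞ c₂ ∧
    (∀ τ, 𝒢.s (c₁ τ) = 𝒢.t (c₂ τ)) ∧
    tangentMap 𝓘(ℝ, ℝ) (𝓡 n) c₁ ⟨0, (1 : ℝ)⟩ = ⟨g, v⟩ ∧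
    tangentMap 𝓘(ℝ, ℝ) (𝓡 n) c₂ ⟨0, (1 : ℝ)⟩ = ⟨h, w⟩ ∧
    tangentMap 𝓘(ℝ, ℝ) (𝓡 n) (fun τ => 𝒢.mul (c₁ τ) (c₂ τ)) ⟨0, (1 : ℝ)⟩ = ⟨𝒢.mul g h, z⟩

/-- `(α, β, γ)` annihilates the tangent space at `(g, h, gh)` of the graph of multiplication. -/
def Conormal (𝒢 : LieGroupoid n m Γ M) (g h : Γ) (α : TangentSpace (𝓡 n) g →L[ℝ] ℝ)
    (β : TangentSpace (𝓡 n) h →L[ℝ] ℝ) (γ : TangentSpace (𝓡 n) (𝒢.mul g h) →L[ℝ] ℝ) : Prop :=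
  ∀ v w z, 𝒢.TangentGraph g h v w z → α v + β w + γ z = 0

/-- An infinitesimal automorphism of the groupoid: a vector field on `Γ` which is a morphism of
groupoids `Γ → TΓ` over some vector field `X₀` on `M`. -/
def IsInfAut (𝒢 : LieGroupoid n m Γ M) (X : ∀ g : Γ, TangentSpace (𝓡 n) g) : Prop :=
  (∃ X₀ : ∀ x : M, TangentSpace (𝓡 m) x,
    (∀ g, mfderiv (𝓡 n) (𝓡 m) 𝒢.s g (X g) = X₀ (𝒢.s g)) ∧
    (∀ g, mfderiv (𝓡 n) (𝓡 m) 𝒢.t g (X g) = X₀ (𝒢.t g)) ∧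
    ∀ x, mfderiv (𝓡 m) (𝓡 n) 𝒢.u x (X₀ x) = X (𝒢.u x)) ∧
  ∀ g h, 𝒢.s g = 𝒢.t h → 𝒢.TangentGraph g h (X g) (X h) (X (𝒢.mul g h))

/-- Left-invariant vector fields on a groupoid: `V (gh)` is the left translate of `V h` by `g`;
in particular `V` is tangent to the fibres of `t`. -/
def IsLeftInvariant (𝒢 : LieGroupoid n m Γ M) (V : ∀ g : Γ, TangentSpace (𝓡 n) g) : Prop :=
  ∀ g h, 𝒢.s g = 𝒢.t h → 𝒢.TangentGraph g h 0 (V h) (V (𝒢.mul g h))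

end LieGroupoid

variable {𝔤 : Type*} [LieRing 𝔤] [LieAlgebra ℝ 𝔤] [FiniteDimensional ℝ 𝔤]

/-- Fusion multiplicativity: the graph of multiplication is coisotropic in `Γ × Γ × Γ` for the
bivector field `π₁ + π₂ + ½ ∑ ρ₁(e^i) ∧ ρ₂(e_i) - π₃`. -/
def IsFusionMultiplicative (𝒢 : LieGroupoid n m Γ M) (B : InvForm 𝔤) (ρ : GAction 𝔤 n Γ)
    (π : BivectorField n Γ) : Prop :=
  ∀ g h, 𝒢.s g = 𝒢.t h → ∀ α β γ α' β' γ', 𝒢.Conormal g h α β γ → 𝒢.Conormal g h α' β' γ' →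
    α' (π.sharp g α) + β' (π.sharp h β) +
      2⁻¹ * ∑ i, (β (ρ.act h (B.lo i)) * α' (ρ.act g (B.up i)) -
        α (ρ.act g (B.up i)) * β' (ρ.act h (B.lo i))) -
      γ' (π.sharp (𝒢.mul g h) γ) = 0

variable {k : ℕ} {G : Type*} [TopologicalSpace G] [ChartedSpace (EuclideanSpace ℝ (Fin k)) G]
  [Group G] [LieGroup (𝓡 k) ∞ G]

/-- Hamiltonian quasi-Poisson `𝔤`-groupoids. -/
structure IsHamQPGroupoid (𝒢 : LieGroupoid n m Γ M) (B : InvForm (GroupLieAlgebra (𝓡 k) G))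
    (ρ : GAction (GroupLieAlgebra (𝓡 k) G) n Γ) (π : BivectorField n Γ) (Φ : Γ → G) : Prop where
  quasiPoisson : IsQuasiPoisson B ρ π
  momentMap : IsMomentMap B ρ π Φ
  map_mul : ∀ g h, 𝒢.s g = 𝒢.t h → Φ (𝒢.mul g h) = Φ g * Φ h
  infAut : ∀ ξ, 𝒢.IsInfAut (fun g => ρ.act g ξ)
  fusion : IsFusionMultiplicative 𝒢 B ρ π

end Groupoids

section Bialgebroids
variable {m r : ℕ} {M : Type*} [TopologicalSpace M] [ChartedSpace (EuclideanSpace ℝ (Fin m)) M]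
  [IsManifold (𝓡 m) ∞ M]

/-- Smooth functions. -/
abbrev Fn (m : ℕ) (M : Type*) [TopologicalSpace M] [ChartedSpace (EuclideanSpace ℝ (Fin m)) M] :=
  C^∞⟮𝓡 m, M; ℝ⟯

/-- Smooth sections of a vector bundle of rank `r`. -/
abbrev Sec (m r : ℕ) {M : Type*} [TopologicalSpace M]
    [ChartedSpace (EuclideanSpace ℝ (Fin m)) M] (A : M → Type*)
    [TopologicalSpace (Bundle.TotalSpace (EuclideanSpace ℝ (Fin r)) A)]
    [∀ x, TopologicalSpace (A x)] [∀ x, AddCommGroup (A x)] [∀ x, Module ℝ (A x)]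
    [FiberBundle (EuclideanSpace ℝ (Fin r)) A] [VectorBundle ℝ (EuclideanSpace ℝ (Fin r)) A] :=
  Cₛ^∞⟮𝓡 m; EuclideanSpace ℝ (Fin r), A⟯

/-- Multisections `Γ(⋀ A)`, as the exterior algebra over smooth functions of the module of
sections. -/
abbrev MSec (m r : ℕ) {M : Type*} [TopologicalSpace M]
    [ChartedSpace (EuclideanSpace ℝ (Fin m)) M] (A : M → Type*)
    [TopologicalSpace (Bundle.TotalSpace (EuclideanSpace ℝ (Fin r)) A)]
    [∀ x, TopologicalSpace (A x)] [∀ x, AddCommGroup (A x)] [∀ x, Module ℝ (A x)]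
    [FiberBundle (EuclideanSpace ℝ (Fin r)) A] [VectorBundle ℝ (EuclideanSpace ℝ (Fin r)) A] :=
  ExteriorAlgebra (Fn m M) (Sec m r A)

/-- A Lie algebroid structure on a vector bundle `A` over `M`. -/
structure LieAlgebroid (m r : ℕ) {M : Type*} [TopologicalSpace M]
    [ChartedSpace (EuclideanSpace ℝ (Fin m)) M] [IsManifold (𝓡 m) ∞ M] (A : M → Type*)
    [TopologicalSpace (Bundle.TotalSpace (EuclideanSpace ℝ (Fin r)) A)]
    [∀ x, TopologicalSpace (A x)] [∀ x, AddCommGroup (A x)] [∀ x, Module ℝ (A x)]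
    [FiberBundle (EuclideanSpace ℝ (Fin r)) A] [VectorBundle ℝ (EuclideanSpace ℝ (Fin r)) A]
    extends LieRinehart (Fn m M) (Sec m r A) where
  /-- The anchor, as a bundle map to the tangent bundle. -/
  anchorMap : ∀ x : M, A x →ₗ[ℝ] TangentSpace (𝓡 m) x
  anchor_eq : ∀ (X : Sec m r A) (f : Fn m M) (x : M), anchor X f x = dfun f x (anchorMap x (X x))

variable {A : M → Type*}
    [TopologicalSpace (Bundle.TotalSpace (EuclideanSpace ℝ (Fin r)) A)]
    [∀ x, TopologicalSpace (A x)] [∀ x, AddCommGroup (A x)] [∀ x, Module ℝ (A x)]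
    [FiberBundle (EuclideanSpace ℝ (Fin r)) A] [VectorBundle ℝ (EuclideanSpace ℝ (Fin r)) A]

/-- A quasi-Poisson `𝔤`-bialgebroid `(A, ρ, 𝒟)`. -/
structure QPBialgebroid {𝔤 : Type*} [LieRing 𝔤] [LieAlgebra ℝ 𝔤] [FiniteDimensional ℝ 𝔤]
    (B : InvForm 𝔤) (m r : ℕ) {M : Type*} [TopologicalSpace M]
    [ChartedSpace (EuclideanSpace ℝ (Fin m)) M] [IsManifold (𝓡 m) ∞ M] (A : M → Type*)
    [TopologicalSpace (Bundle.TotalSpace (EuclideanSpace ℝ (Fin r)) A)]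
    [∀ x, TopologicalSpace (A x)] [∀ x, AddCommGroup (A x)] [∀ x, Module ℝ (A x)]
    [FiberBundle (EuclideanSpace ℝ (Fin r)) A] [VectorBundle ℝ (EuclideanSpace ℝ (Fin r)) A]
    extends LieAlgebroid m r A where
  /-- The action of `𝔤` on constant sections of `M × 𝔤`. -/
  ρ : 𝔤 →ₗ[ℝ] Sec m r A
  ρ_lie : ∀ ξ η, ρ ⁅ξ, η⁆ = bracket (ρ ξ) (ρ η)
  /-- The derivation of the Gerstenhaber algebra of multisections. -/
  𝒟 : MSec m r A →ₗ[ℝ] MSec m r A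
  𝒟_degree : ∀ (d : ℕ) (P : MSec m r A), P ∈ ⋀[Fn m M]^d (Sec m r A) →
    𝒟 P ∈ ⋀[Fn m M]^(d + 1) (Sec m r A)
  𝒟_mul : ∀ P Q, 𝒟 (P * Q) = 𝒟 P * Q + CliffordAlgebra.involute P * 𝒟 Q
  𝒟_schouten : ∀ P Q, 𝒟 (toLieRinehart.schouten P Q) = toLieRinehart.schouten (𝒟 P) Q -
    toLieRinehart.schouten (CliffordAlgebra.involute P) (𝒟 Q)
  𝒟_ρ : ∀ ξ, 𝒟 (ExteriorAlgebra.ι _ (ρ ξ)) = 0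
  𝒟_sq : ∀ P, 𝒟 (𝒟 P) = (2⁻¹ : ℝ) • toLieRinehart.schouten (B.phiImage ρ) P

namespace QPBialgebroid
variable {𝔤 : Type*} [LieRing 𝔤] [LieAlgebra ℝ 𝔤] [FiniteDimensional ℝ 𝔤] {B : InvForm 𝔤}

/-- The section `𝒟 f` of `A`, for a function `f`. -/
noncomputable def 𝒟fun (𝒜 : QPBialgebroid B m r A) (f : Fn m M) : Sec m r A :=
  ExteriorAlgebra.ιInv (𝒜.𝒟 (algebraMap (Fn m M) (MSec m r A) f))

/-- The operator `𝒟 + ½ ∑ ρ(e^i) ∧ [ρ(e_i), ·]`, the differential of the Lie algebroid `A*`. -/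
noncomputable def dDual (𝒜 : QPBialgebroid B m r A) (P : MSec m r A) : MSec m r A :=
  𝒜.𝒟 P + (2⁻¹ : ℝ) • ∑ i, ExteriorAlgebra.ι _ (𝒜.ρ (B.up i)) *
    𝒜.toLieRinehart.schouten (ExteriorAlgebra.ι _ (𝒜.ρ (B.lo i))) P

end QPBialgebroid
end Bialgebroids

section Correspondence
variable {k m n r : ℕ}
  {G : Type*} [TopologicalSpace G] [ChartedSpace (EuclideanSpace ℝ (Fin k)) G]
  [Group G] [LieGroup (𝓡 k) ∞ G]
  {Γ M : Type*}
  [TopologicalSpace Γ] [ChartedSpace (EuclideanSpace ℝ (Fin n)) Γ] [IsManifold (𝓡 n) ∞ Γ]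
  [TopologicalSpace M] [ChartedSpace (EuclideanSpace ℝ (Fin m)) M] [IsManifold (𝓡 m) ∞ M]
  {A : M → Type*}
  [TopologicalSpace (Bundle.TotalSpace (EuclideanSpace ℝ (Fin r)) A)]
  [∀ x, TopologicalSpace (A x)] [∀ x, AddCommGroup (A x)] [∀ x, Module ℝ (A x)]
  [FiberBundle (EuclideanSpace ℝ (Fin r)) A] [VectorBundle ℝ (EuclideanSpace ℝ (Fin r)) A]
  {B : InvForm (GroupLieAlgebra (𝓡 k) G)}

/-- The correspondence between a Hamiltonian quasi-Poisson `𝔤`-groupoid `(Γ, ρ, π, Φ)` and a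
quasi-Poisson `𝔤`-bialgebroid `(A, ρ_A, 𝒟)`. The Lie algebroid `Lie(Γ)` of `Γ` consists of left-invariant
vector fields: its fibre at `x` is `ker dt` at the unit of `x`, its anchor is `ds`. The fibre `A x` is
identified by `κ` with the conormal space of `M` in `Γ` at `x`, which is the dual of `ker dt`, so that
`A* ≅ Lie(Γ)` as vector bundles. The conditions say:
* `A* ≅ Lie(Γ)` as Lie algebroids, where the Lie algebroid structure of `A*` is the one with
  differential `𝒟 + ½ ∑ ρ_A(e^i) ∧ [ρ_A(e_i), ·]` (`anchor_dual`, `bracket_dual`);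
* `Φ` integrates the morphism `μ : A* → 𝔤` dual to `ρ_A` (`moment`);
* the Lie algebroid structure of `A`, seen as the conormal bundle of `M`, is the restriction of that
  of `T*Γ`, which has the anchor `π♯ + ½ ρ ∘ ρ*` and the bracket
  `[df, dg] = d{f, g} + ½ ∑ (df(ρ(e^i)) L_{ρ(e_i)} dg - dg(ρ(e^i)) L_{ρ(e_i)} df)`
  (`anchor`, `bracket`). -/
structure Correspondence (𝒢 : LieGroupoid n m Γ M)
    (ρ : GAction (GroupLieAlgebra (𝓡 k) G) n Γ) (π : BivectorField n Γ) (Φ : Γ → G)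
    (𝒜 : QPBialgebroid B m r A) where
  /-- The identification of `A` with the conormal bundle of the units. -/
  κ : ∀ x : M, A x →ₗ[ℝ] TangentSpace (𝓡 n) (𝒢.u x) →L[ℝ] ℝ
  κ_smooth : ∀ a : Sec m r A, ContMDiff (𝓡 m)
    ((𝓡 n).prod 𝓘(ℝ, EuclideanSpace ℝ (Fin n) →L[ℝ] ℝ)) ∞
    (fun x ↦ Bundle.TotalSpace.mk' (EuclideanSpace ℝ (Fin n) →L[ℝ] ℝ)
      (E := fun g : Γ => TangentSpace (𝓡 n) g →L[ℝ] ℝ) (𝒢.u x) (κ x (a x)))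
  κ_injective : ∀ x, Function.Injective (κ x)
  κ_range : ∀ x (α : TangentSpace (𝓡 n) (𝒢.u x) →L[ℝ] ℝ),
    (∃ a, κ x a = α) ↔ ∀ v, α (mfderiv (𝓡 m) (𝓡 n) 𝒢.u x v) = 0
  /-- `(d_{A*} f)(v) = ds(v) f` for `v` in `ker dt`. -/
  anchor_dual : ∀ (f : Fn m M) (x : M) (v : TangentSpace (𝓡 n) (𝒢.u x)),
    mfderiv (𝓡 n) (𝓡 m) 𝒢.t (𝒢.u x) v = 0 →
    κ x (ExteriorAlgebra.ιInv (𝒜.dDual (algebraMap (Fn m M) (MSec m r A) f)) x) v =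
      dfun f (𝒢.s (𝒢.u x)) (mfderiv (𝓡 n) (𝓡 m) 𝒢.s (𝒢.u x) v)
  /-- `(d_{A*} a)(V, W) = ds(V) a(W) - ds(W) a(V) - a([V, W])` for left-invariant `V`, `W`. -/
  bracket_dual : ∀ (V W : ∀ g : Γ, TangentSpace (𝓡 n) g) (θ η : Module.Dual (Fn m M) (Sec m r A)),
    SmoothVF V → SmoothVF W → 𝒢.IsLeftInvariant V → 𝒢.IsLeftInvariant W →
    (∀ a x, θ a x = κ x (a x) (V (𝒢.u x))) → (∀ a x, η a x = κ x (a x) (W (𝒢.u x))) →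
    ∀ (a : Sec m r A) (x : M),
      ExteriorAlgebra.algebraMapInv (CliffordAlgebra.contractLeft η
        (CliffordAlgebra.contractLeft θ (𝒜.dDual (ExteriorAlgebra.ι _ a)))) x =
      dfun (η a) (𝒢.s (𝒢.u x)) (mfderiv (𝓡 n) (𝓡 m) 𝒢.s (𝒢.u x) (V (𝒢.u x))) -
      dfun (θ a) (𝒢.s (𝒢.u x)) (mfderiv (𝓡 n) (𝓡 m) 𝒢.s (𝒢.u x) (W (𝒢.u x))) -
      κ x (a x) (VectorField.mlieBracket (𝓡 n) V W (𝒢.u x))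
  /-- `⟨ρ_A(ξ), v⟩ = B(ξ, dΦ(v))`, with `dΦ(v)` identified with `η ∈ 𝔤`. -/
  moment : ∀ (x : M) (ξ η : GroupLieAlgebra (𝓡 k) G) (v : TangentSpace (𝓡 n) (𝒢.u x)),
    mfderiv (𝓡 n) (𝓡 k) Φ (𝒢.u x) v = leftVF η (Φ (𝒢.u x)) →
    κ x (𝒜.ρ ξ x) v = B.form ξ η
  /-- The anchor of `A` is the restriction of the anchor of `T*Γ`. -/
  anchor : ∀ (x : M) (a : A x),
    mfderiv (𝓡 m) (𝓡 n) 𝒢.u x (𝒜.anchorMap x a) = π.sharp (𝒢.u x) (κ x a) +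
      ρ.act (𝒢.u x) ((2⁻¹ : ℝ) • B.sharp (ρ.transpose (κ x a)))
  /-- The bracket of sections of `A` is the restriction of the bracket of `T*Γ`, computed with
  functions whose differentials along the units represent the two sections. -/
  bracket : ∀ (a b : Sec m r A) (x : M) (f g : Γ → ℝ),
    ContMDiffAt (𝓡 n) 𝓘(ℝ, ℝ) ∞ f (𝒢.u x) → ContMDiffAt (𝓡 n) 𝓘(ℝ, ℝ) ∞ g (𝒢.u x) →
    (∀ᶠ y in 𝓝 x, κ y (a y) = dfun f (𝒢.u y)) → (∀ᶠ y in 𝓝 x, κ y (b y) = dfun g (𝒢.u y)) →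
    κ x (𝒜.bracket a b x) = dfun (π.poisson f g) (𝒢.u x) +
      (2⁻¹ : ℝ) • ∑ i, (dfun f (𝒢.u x) (ρ.act (𝒢.u x) (B.up i)) •
          dfun (ρ.deriv (B.lo i) g) (𝒢.u x) -
        dfun g (𝒢.u x) (ρ.act (𝒢.u x) (B.up i)) • dfun (ρ.deriv (B.lo i) f) (𝒢.u x))

end Correspondence

end QP

/-! The bivector field on the base is `s_*π`, read off at the units. Differentiating `s(gh) = s(h)`,
`t(gh) = t(g)` and `s(g) = t(h)` shows that `(0, s*β, -s*β)`, `(t*β, 0, -t*β)` and `(s*β, -t*β, 0)`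
are conormal to the graph of multiplication. Coisotropy, tested on pairs of these, yields four
facts. `π(s*β, s*β')` at `g` equals its value at the unit of `s g` (`source_source`), so `s_*π` is
well defined. The same holds for `t` (`target_target`). At a unit, `t_*π = -s_*π`
(`target_target_unit`): `ρ` projects to one field under `s` and `t`, so the fusion terms cancel. At
a unit, `π(t*β, s*β')` is minus half the pairing of the two pulled-back elements of `𝔤*`
(`target_source_unit`).

The action on the base is the restriction of `ρ` to the units, to which infinitesimal automorphisms
are tangent. Since `s` is a surjective quasi-Poisson map, invariance and the Jacobi identity on the
base are those of `Γ` for functions `f ∘ s` (`isQuasiPoisson`).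

The anchor `𝐚` enters through the anchor `π♯ + ½ ρ ρ*` of `T*Γ`. At a unit `Φ = 1`, so the moment
map condition sends `κ(ρ_A(ξ))` to `ρ(ξ)` under `π♯` and to `0` under `ρ*`; hence `𝐚 ∘ ρ_A` is the
base action (`anchor_ρ`). The section `d_{A*} f` is `s*df - t*df` under `κ` (`κ_dDual`) and `ρ*`
kills it, so `𝐚(d_{A*} f) = ds π♯(s*df) - ds π♯(t*df)`. The last term contributes `½ ∑ df(ρ_M(e_i))
ρ_M(e^i)`, with `ρ_M` the base action: exactly the image under `𝐚` of the difference between `d_{A*}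
f` and `𝒟 f`. What remains is `π_𝒟♯(df) = 𝐚(𝒟 f)` (`anchor_𝒟fun`). -/

namespace QP
-- Vector fields as derivations, and brackets of related fields
section DifferentialCalculus
open VectorField

variable {n : ℕ} {N : Type*} [TopologicalSpace N] [ChartedSpace (EuclideanSpace ℝ (Fin n)) N]
  [IsManifold (𝓡 n) ∞ N]
  {F : Type*} [NormedAddCommGroup F] [NormedSpace ℝ F]

/-- The derivative `X f` of a vector valued function along a vector field. -/
noncomputable def vfDeriv (X : ∀ x : N, TangentSpace (𝓡 n) x) (f : N → F) (x : N) : F :=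
  mfderiv (𝓡 n) 𝓘(ℝ, F) f x (X x)

/-- In coordinates the derivative of `f` is a smooth family of linear maps. Applied to `X` it gives
a smooth map into `TF`, whose fibre component is `X f`. -/
theorem vfDeriv_contMDiffAt {f : N → F} {X : ∀ x : N, TangentSpace (𝓡 n) x} {x : N}
    (hf : ContMDiffAt (𝓡 n) 𝓘(ℝ, F) ∞ f x)
    (hX : ContMDiffAt (𝓡 n) (𝓡 n).tangent ∞ (fun y => (⟨y, X y⟩ : TangentBundle (𝓡 n) N)) x) :
    ContMDiffAt (𝓡 n) 𝓘(ℝ, F) ∞ (vfDeriv X f) x := by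
  have h1 := ContMDiffAt.mfderiv_const (m := ∞) hf le_rfl
  have h2 := ContMDiffAt.clm_apply_of_inCoordinates (b₁ := id) (b₂ := f)
    (E₁ := fun y : N => TangentSpace (𝓡 n) y) (E₂ := fun y : F => TangentSpace 𝓘(ℝ, F) y)
    (IB₂ := 𝓘(ℝ, F))
    (ϕ := fun y => mfderiv (𝓡 n) 𝓘(ℝ, F) f y) (v := fun y => X y) h1 hX hf
  exact ((contMDiff_snd_tangentBundle_modelSpace F 𝓘(ℝ, F)).contMDiffAt (n := ∞)).comp x h2

theorem eventually_mdifferentiableAt {f : N → F} {x : N}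
    (hf : ContMDiffAt (𝓡 n) 𝓘(ℝ, F) ∞ f x) :
    ∀ᶠ y in 𝓝 x, MDifferentiableAt (𝓡 n) 𝓘(ℝ, F) f y := by
  have : IsManifold (𝓡 n) 1 N := IsManifold.of_le (n := ∞) ENat.LEInfty.out
  -- Finite order smoothness at a point spreads to a neighbourhood; for order `∞` the neighbourhood
  -- may shrink with the order.
  have h1 : ContMDiffAt (𝓡 n) 𝓘(ℝ, F) 1 f x := hf.of_le ENat.LEInfty.out
  filter_upwards [(contMDiffAt_iff_contMDiffAt_nhds (by simp)).1 h1] with y hy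
  exact ContMDiffAt.mdifferentiableAt hy one_ne_zero

/-- Vector fields act on functions in such a way that `[X, Y] f = X (Y f) - Y (X f)`. -/
theorem vfDeriv_mlieBracket {f : N → F} {X Y : ∀ x : N, TangentSpace (𝓡 n) x} {x : N}
    (hf : ContMDiffAt (𝓡 n) 𝓘(ℝ, F) ∞ f x)
    (hX : ContMDiffAt (𝓡 n) (𝓡 n).tangent ∞ (fun y => (⟨y, X y⟩ : TangentBundle (𝓡 n) N)) x)
    (hY : ContMDiffAt (𝓡 n) (𝓡 n).tangent ∞ (fun y => (⟨y, Y y⟩ : TangentBundle (𝓡 n) N)) x) :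
    vfDeriv (mlieBracket (𝓡 n) X Y) f x =
      vfDeriv X (vfDeriv Y f) x - vfDeriv Y (vfDeriv X f) x := by
  set φ := extChartAt (𝓡 n) x with hφ
  have hr : Set.range (𝓡 n) = Set.univ := by simp
  have hz : φ.symm (φ x) = x := extChartAt_to_inv x
  -- The vector field read in the chart at `x`. The identity is transported to the model space,
  -- where it expresses the symmetry of the second derivative.
  let pb : (∀ x : N, TangentSpace (𝓡 n) x) → EuclideanSpace ℝ (Fin n) → EuclideanSpace ℝ (Fin n) :=
    fun X => mpullbackWithin 𝓘(ℝ, EuclideanSpace ℝ (Fin n)) (𝓡 n) φ.symm X (Set.range (𝓡 n))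
  have hpb : ∀ X : (∀ x : N, TangentSpace (𝓡 n) x), ContMDiffAt (𝓡 n) (𝓡 n).tangent ∞
      (fun y => (⟨y, X y⟩ : TangentBundle (𝓡 n) N)) x → DifferentiableAt ℝ (pb X) (φ x) := by
    intro X hX
    have : DifferentiableWithinAt ℝ (pb X) (φ.symm ⁻¹' Set.univ ∩ Set.range (𝓡 n)) (φ x) :=
      ((hX.mdifferentiableAt (by simp)).mdifferentiableWithinAt
        (s := Set.univ)).differentiableWithinAt_mpullbackWithin_vectorField
    rwa [Set.preimage_univ, Set.univ_inter, hr, differentiableWithinAt_univ] at this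
  have htgt : φ.target ∈ 𝓝 (φ x) := extChartAt_target_mem_nhds x
  have hsymm : ∀ w ∈ φ.target,
      MDifferentiableAt 𝓘(ℝ, EuclideanSpace ℝ (Fin n)) (𝓡 n) φ.symm w := by
    intro w hw
    have := mdifferentiableWithinAt_extChartAt_symm (I := 𝓡 n) (x := x) hw
    rwa [hr, mdifferentiableWithinAt_univ] at this
  have hder : ∀ (g : N → F) (X : ∀ x : N, TangentSpace (𝓡 n) x), ∀ w ∈ φ.target,
      MDifferentiableAt (𝓡 n) 𝓘(ℝ, F) g (φ.symm w) →
      fderiv ℝ (g ∘ φ.symm) w (pb X w) = vfDeriv X g (φ.symm w) := by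
    intro g X w hw hg
    have hinv := isInvertible_mfderivWithin_extChartAt_symm (I := 𝓡 n) (x := x) hw
    have h1 := mfderiv_comp w hg (hsymm w hw)
    rw [mfderiv_eq_fderiv] at h1
    have h2 := hinv.self_apply_inverse (X (φ.symm w))
    rw [hr, mfderivWithin_univ] at h2
    have h3 : mfderiv 𝓘(ℝ, EuclideanSpace ℝ (Fin n)) (𝓡 n) φ.symm w (pb X w) = X (φ.symm w) := by
      change mfderiv 𝓘(ℝ, EuclideanSpace ℝ (Fin n)) (𝓡 n) φ.symm w
        ((mfderivWithin _ _ _ _ w).inverse (X (φ.symm w))) = _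
      rw [hr, mfderivWithin_univ]
      exact h2
    refine (DFunLike.congr_fun h1 _).trans ?_
    exact congrArg (mfderiv (𝓡 n) 𝓘(ℝ, F) g (φ.symm w)) h3
  have hcd : ContDiffAt ℝ 2 (f ∘ φ.symm) (φ x) := by
    have h0 : ContMDiffAt 𝓘(ℝ, EuclideanSpace ℝ (Fin n)) (𝓡 n) ∞ φ.symm (φ x) :=
      (contMDiffOn_extChartAt_symm (n := ∞) x).contMDiffAt htgt
    exact (ContMDiffAt.comp_of_eq hf h0 hz).contDiffAt.of_le ENat.LEInfty.out
  -- The manifold bracket is the chart bracket pulled back by the derivative of the chart, which is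
  -- the identity at the centre of the chart.
  have hlie : mlieBracket (𝓡 n) X Y x = lieBracket ℝ (E := EuclideanSpace ℝ (Fin n)) (pb X) (pb Y) (φ x) := by
    have hid : ∀ D : EuclideanSpace ℝ (Fin n) →L[ℝ] EuclideanSpace ℝ (Fin n),
        D = ContinuousLinearMap.id ℝ _ → ∀ v, D.inverse v = v := by
      rintro _ rfl v
      rw [ContinuousLinearMap.inverse_id]; rfl
    refine (hid _ mfderiv_extChartAt_self (lieBracketWithin ℝ (E := EuclideanSpace ℝ (Fin n))
      (pb X) (pb Y) (φ.symm ⁻¹' Set.univ ∩ Set.range (𝓡 n)) (φ x))).trans ?_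
    rw [Set.preimage_univ, Set.univ_inter, hr, lieBracketWithin_univ]
  -- These functions are differentiated once more, so they must agree near the point, not only at
  -- it.
  have hev : ∀ X : (∀ x : N, TangentSpace (𝓡 n) x),
      (fun w => fderiv ℝ (f ∘ φ.symm) w (pb X w)) =ᶠ[𝓝 (φ x)] vfDeriv X f ∘ φ.symm := by
    intro X
    have hc : Filter.Tendsto φ.symm (𝓝 (φ x)) (𝓝 x) := by
      have := continuousAt_extChartAt_symm (I := 𝓡 n) x
      rwa [ContinuousAt, ← hφ, hz] at this
    filter_upwards [htgt, hc.eventually (eventually_mdifferentiableAt hf)] with w hw hw'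
    exact hder f X w hw hw'
  have hxt : φ x ∈ φ.target := mem_of_mem_nhds htgt
  have hsm : ∀ (g : N → F), ContMDiffAt (𝓡 n) 𝓘(ℝ, F) ∞ g x →
      MDifferentiableAt (𝓡 n) 𝓘(ℝ, F) g (φ.symm (φ x)) := fun g hg => by
    rw [hz]; exact hg.mdifferentiableAt (by simp)
  have key := fderiv_apply_lieBracket (n := 2) hcd (by simp) (hpb Y hY) (hpb X hX)
  rw [(hev X).fderiv_eq, (hev Y).fderiv_eq,
    hder _ _ _ hxt (hsm _ (vfDeriv_contMDiffAt hf hX)),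
    hder _ _ _ hxt (hsm _ (vfDeriv_contMDiffAt hf hY)), hz] at key
  rw [← key]
  have h1 := mfderiv_comp (φ x) (hsm f hf) (hsymm _ hxt)
  rw [mfderiv_eq_fderiv] at h1
  refine Eq.trans ?_ (DFunLike.congr_fun h1 _).symm
  have h4 : (mfderivWithin 𝓘(ℝ, EuclideanSpace ℝ (Fin n)) (𝓡 n) φ.symm (Set.range (𝓡 n)) (φ x) :
      EuclideanSpace ℝ (Fin n) →L[ℝ] EuclideanSpace ℝ (Fin n)) =
      ContinuousLinearMap.id ℝ (EuclideanSpace ℝ (Fin n)) := mfderivWithin_range_extChartAt_symm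
  rw [hr, mfderivWithin_univ] at h4
  have h5 : ∀ v : EuclideanSpace ℝ (Fin n), mfderiv 𝓘(ℝ, EuclideanSpace ℝ (Fin n)) (𝓡 n)
      φ.symm (φ x) v = v := fun v => DFunLike.congr_fun h4 v
  refine Eq.trans ?_ (congrArg (mfderiv (𝓡 n) 𝓘(ℝ, F) f (φ.symm (φ x))) (h5 _)).symm
  rw [← hlie, hz]
  rfl

variable {n' : ℕ} {N' : Type*} [TopologicalSpace N']
  [ChartedSpace (EuclideanSpace ℝ (Fin n')) N'] [IsManifold (𝓡 n') ∞ N']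

omit [IsManifold (𝓡 n) ∞ N] [IsManifold (𝓡 n') ∞ N'] in
theorem vfDeriv_comp {u : N → N'} {X : ∀ x : N, TangentSpace (𝓡 n) x}
    {X' : ∀ x : N', TangentSpace (𝓡 n') x} {f : N' → F} {x : N}
    (hf : MDifferentiableAt (𝓡 n') 𝓘(ℝ, F) f (u x))
    (hu : MDifferentiableAt (𝓡 n) (𝓡 n') u x)
    (h : mfderiv (𝓡 n) (𝓡 n') u x (X x) = X' (u x)) :
    vfDeriv X (f ∘ u) x = vfDeriv X' f (u x) := by
  change mfderiv (𝓡 n) 𝓘(ℝ, F) (f ∘ u) x (X x) = mfderiv (𝓡 n') 𝓘(ℝ, F) f (u x) (X' (u x))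
  rw [mfderiv_comp x hf hu, ← h]
  rfl

/-- The bracket of related vector fields is related. -/
theorem mfderiv_mlieBracket_of_related {u : N → N'} (hu : ContMDiff (𝓡 n) (𝓡 n') ∞ u)
    {X Y : ∀ x : N, TangentSpace (𝓡 n) x} {X' Y' : ∀ x : N', TangentSpace (𝓡 n') x}
    (hX : SmoothVF X) (hY : SmoothVF Y) (hX' : SmoothVF X') (hY' : SmoothVF Y')
    (hXX' : ∀ x, mfderiv (𝓡 n) (𝓡 n') u x (X x) = X' (u x))
    (hYY' : ∀ x, mfderiv (𝓡 n) (𝓡 n') u x (Y x) = Y' (u x)) (x : N) :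
    mfderiv (𝓡 n) (𝓡 n') u x (mlieBracket (𝓡 n) X Y x) = mlieBracket (𝓡 n') X' Y' (u x) := by
  have hd : ∀ y, MDifferentiableAt (𝓡 n) (𝓡 n') u y := fun y => (hu y).mdifferentiableAt (by simp)
  -- A chart is a vector valued test function with injective derivative, so two tangent vectors at
  -- `u x` agree as soon as they differentiate it equally.
  let f : N' → EuclideanSpace ℝ (Fin n') := ⇑(extChartAt (𝓡 n') (u x))
  have hf : ContMDiffAt (𝓡 n') 𝓘(ℝ, EuclideanSpace ℝ (Fin n')) ∞ f (u x) := contMDiffAt_extChartAt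
  have hfu : ContMDiffAt (𝓡 n) 𝓘(ℝ, EuclideanSpace ℝ (Fin n')) ∞ (f ∘ u) x := hf.comp x (hu x)
  have hfd : MDifferentiableAt (𝓡 n') 𝓘(ℝ, EuclideanSpace ℝ (Fin n')) f (u x) :=
    hf.mdifferentiableAt (by simp)
  have hinj : Function.Injective (mfderiv (𝓡 n') 𝓘(ℝ, EuclideanSpace ℝ (Fin n')) f (u x)) :=
    (isInvertible_mfderiv_extChartAt (mem_extChartAt_source (u x))).injective
  have hev : ∀ {Z : ∀ x : N, TangentSpace (𝓡 n) x} {Z' : ∀ x : N', TangentSpace (𝓡 n') x},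
      (∀ x, mfderiv (𝓡 n) (𝓡 n') u x (Z x) = Z' (u x)) →
      vfDeriv Z (f ∘ u) =ᶠ[𝓝 x] vfDeriv Z' f ∘ u := by
    intro Z Z' hZ
    filter_upwards [(hu x).continuousAt.eventually (eventually_mdifferentiableAt hf)] with y hy
    exact vfDeriv_comp hy (hd y) (hZ y)
  have htwo : ∀ {Z W : ∀ x : N, TangentSpace (𝓡 n) x} {Z' W' : ∀ x : N', TangentSpace (𝓡 n') x},
      SmoothVF W' → (∀ x, mfderiv (𝓡 n) (𝓡 n') u x (Z x) = Z' (u x)) →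
      (∀ x, mfderiv (𝓡 n) (𝓡 n') u x (W x) = W' (u x)) →
      vfDeriv Z (vfDeriv W (f ∘ u)) x = vfDeriv Z' (vfDeriv W' f) (u x) := by
    intro Z W Z' W' hWs hZ hW
    have h1 : vfDeriv Z (vfDeriv W (f ∘ u)) x = vfDeriv Z (vfDeriv W' f ∘ u) x :=
      congrArg (fun T : TangentSpace (𝓡 n) x →L[ℝ] EuclideanSpace ℝ (Fin n') => T (Z x))
        (hev hW).mfderiv_eq
    rw [h1]
    exact vfDeriv_comp ((vfDeriv_contMDiffAt hf (hWs _)).mdifferentiableAt (by simp)) (hd x) (hZ x)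
  apply hinj
  -- Relatedness is needed only at `x`, so the comparison field may take the same model vector at
  -- every point.
  have h1 := vfDeriv_comp (X := mlieBracket (𝓡 n) X Y)
    (X' := fun y => mfderiv (𝓡 n) (𝓡 n') u x (mlieBracket (𝓡 n) X Y x)) hfd (hd x) rfl
  refine h1.symm.trans ?_
  rw [vfDeriv_mlieBracket hfu (hX x) (hY x), htwo hY' hXX' hYY', htwo hX' hYY' hXX',
    ← vfDeriv_mlieBracket hf (hX' _) (hY' _)]
  rfl
end DifferentialCalculus
end QP

namespace QP
-- Smoothness of bivector fields and their push-forward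
section Bivectors
variable {n : ℕ} {N : Type*} [TopologicalSpace N] [ChartedSpace (EuclideanSpace ℝ (Fin n)) N]
  [IsManifold (𝓡 n) ∞ N]

/-- The cotangent trivialization is precomposition with the inverse of the tangent one, so its
inverse is precomposition with the tangent trivialization. Used to compute sharp maps in
coordinates. -/
theorem cotangent_symmL {x y : N}
    (hy : y ∈ (trivializationAt (EuclideanSpace ℝ (Fin n)) (TangentSpace (𝓡 n)) x).baseSet)
    (L : EuclideanSpace ℝ (Fin n) →L[ℝ] ℝ) :
    (trivializationAt (EuclideanSpace ℝ (Fin n) →L[ℝ] ℝ)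
      (fun b : N => TangentSpace (𝓡 n) b →L[ℝ] ℝ) x).symmL ℝ y L =
    L ∘L (trivializationAt (EuclideanSpace ℝ (Fin n)) (TangentSpace (𝓡 n))
      x).continuousLinearMapAt ℝ y := by
  set e := trivializationAt (EuclideanSpace ℝ (Fin n)) (TangentSpace (𝓡 n)) x
  set e' := trivializationAt (EuclideanSpace ℝ (Fin n) →L[ℝ] ℝ)
    (fun b : N => TangentSpace (𝓡 n) b →L[ℝ] ℝ) x
  have hy' : y ∈ e'.baseSet := ⟨hy, Set.mem_univ y⟩
  have h : e'.continuousLinearMapAt ℝ y (L ∘L e.continuousLinearMapAt ℝ y) = L := by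
    rw [Bundle.Trivialization.continuousLinearMapAt_apply, e'.coe_linearMapAt_of_mem hy']
    ext v
    change (trivializationAt ℝ (Bundle.Trivial N ℝ) x).continuousLinearMapAt ℝ y
      (L (e.continuousLinearMapAt ℝ y (e.symmL ℝ y v))) = L v
    rw [e.continuousLinearMapAt_symmL hy]
    simp
  conv_lhs => rw [← h]
  exact e'.symmL_continuousLinearMapAt hy' _

/-- The coordinate form of this section is that of `mfderiv`, since the bundle `ℝ` is trivialized by
the identity. -/
theorem dfun_contMDiffAt {f : N → ℝ} {x : N} (hf : ContMDiffAt (𝓡 n) 𝓘(ℝ, ℝ) ∞ f x) :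
    ContMDiffAt (𝓡 n) ((𝓡 n).prod 𝓘(ℝ, EuclideanSpace ℝ (Fin n) →L[ℝ] ℝ)) ∞
      (fun y ↦ Bundle.TotalSpace.mk' (EuclideanSpace ℝ (Fin n) →L[ℝ] ℝ)
        (E := fun y : N => TangentSpace (𝓡 n) y →L[ℝ] ℝ) y (dfun f y)) x := by
  rw [contMDiffAt_hom_bundle]
  refine ⟨contMDiffAt_id, (ContMDiffAt.mfderiv_const (m := ∞) hf le_rfl).congr_of_eventuallyEq
    (Filter.Eventually.of_forall fun y => ?_)⟩
  ext v
  simp [inTangentCoordinates, ContinuousLinearMap.inCoordinates]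
  rfl

theorem BivectorField.sharp_dfun_contMDiffAt (π : BivectorField n N) {f : N → ℝ} {x : N}
    (hf : ContMDiffAt (𝓡 n) 𝓘(ℝ, ℝ) ∞ f x) :
    ContMDiffAt (𝓡 n) (𝓡 n).tangent ∞
      (fun y => (⟨y, π.sharp y (dfun f y)⟩ : TangentBundle (𝓡 n) N)) x :=
  ContMDiffAt.clm_bundle_apply (π.smooth x) (dfun_contMDiffAt hf)

theorem BivectorField.poisson_contMDiffAt (π : BivectorField n N) {f g : N → ℝ} {x : N}
    (hf : ContMDiffAt (𝓡 n) 𝓘(ℝ, ℝ) ∞ f x) (hg : ContMDiffAt (𝓡 n) 𝓘(ℝ, ℝ) ∞ g x) :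
    ContMDiffAt (𝓡 n) 𝓘(ℝ, ℝ) ∞ (π.poisson f g) x :=
  vfDeriv_contMDiffAt hg (π.sharp_dfun_contMDiffAt hf)

variable {m : ℕ} {M : Type*} [TopologicalSpace M] [ChartedSpace (EuclideanSpace ℝ (Fin m)) M]
  [IsManifold (𝓡 m) ∞ M]

/-- The push-forward by `s` of a bivector field, restricted to the image of a section `u` of `s`. -/
noncomputable def BivectorField.pushAlong (π : BivectorField n N) (s : N → M) (u : M → N)
    (hs : ContMDiff (𝓡 n) (𝓡 m) ∞ s) (hu : ContMDiff (𝓡 m) (𝓡 n) ∞ u) (hsu : ∀ x, s (u x) = x) :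
    BivectorField m M where
  sharp x :=
    let D : TangentSpace (𝓡 n) (u x) →L[ℝ] TangentSpace (𝓡 m) x := mfderiv (𝓡 n) (𝓡 m) s (u x)
    D ∘L (π.sharp (u x)) ∘L (D.precomp ℝ)
  skew x α β :=
    π.skew (u x) (α ∘L mfderiv (𝓡 n) (𝓡 m) s (u x)) (β ∘L mfderiv (𝓡 n) (𝓡 m) s (u x))
  smooth := by
    intro x₀
    rw [contMDiffAt_hom_bundle]
    refine ⟨contMDiffAt_id, ?_⟩
    have hπ := (π.smooth (u x₀)).comp x₀ (hu x₀)
    rw [contMDiffAt_hom_bundle] at hπ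
    have hA := hπ.2
    have hD := ContMDiffAt.mfderiv (m := ∞) (n := ∞) (x₀ := x₀) (fun _ => s) u
      ((hs _).comp (x₀, u x₀) contMDiffAt_snd) (hu x₀) le_rfl
    -- This makes the coordinates on the target of `ds` those centred at `x₀`, as the hom bundle
    -- requires.
    have hsu' : (fun x => s (u x)) = fun x => x := funext hsu
    rw [hsu'] at hD
    have hD' := hD.clm_precomp (F₃ := ℝ)
    -- The product of the coordinate matrices of `ds`, `π♯` and the transpose of `ds` is smooth.
    -- Near `x₀` it is the coordinate matrix of the composite, because the trivializations at `u x₀`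
    -- between the factors cancel.
    refine ((hD.clm_comp (hA.clm_comp hD'))).congr_of_eventuallyEq ?_
    have hN := (hu x₀).continuousAt.eventually ((trivializationAt (EuclideanSpace ℝ (Fin n))
      (TangentSpace (𝓡 n)) (u x₀)).open_baseSet.mem_nhds
        (FiberBundle.mem_baseSet_trivializationAt' (u x₀)))
    have hM := (trivializationAt (EuclideanSpace ℝ (Fin m))
      (TangentSpace (𝓡 m)) x₀).open_baseSet.mem_nhds (FiberBundle.mem_baseSet_trivializationAt' x₀)
    filter_upwards [hN, hM] with x hxN hxM
    ext1 L
    have e1 := cotangent_symmL hxM L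
    set eN := trivializationAt (EuclideanSpace ℝ (Fin n)) (TangentSpace (𝓡 n)) (u x₀)
    set eM := trivializationAt (EuclideanSpace ℝ (Fin m)) (TangentSpace (𝓡 m)) x₀
    let D : TangentSpace (𝓡 n) (u x) →L[ℝ] TangentSpace (𝓡 m) x := mfderiv (𝓡 n) (𝓡 m) s (u x)
    have e2 := cotangent_symmL hxN (L ∘L eM.continuousLinearMapAt ℝ x ∘L D ∘L eN.symmL ℝ (u x))
    have hid : ∀ v : TangentSpace (𝓡 n) (u x), eN.symmL ℝ (u x) (eN.continuousLinearMapAt ℝ (u x) v)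
        = v := fun v => eN.symmL_continuousLinearMapAt hxN v
    have e3 : (L ∘L eM.continuousLinearMapAt ℝ x ∘L D ∘L eN.symmL ℝ (u x)) ∘L
        eN.continuousLinearMapAt ℝ (u x) = (L ∘L eM.continuousLinearMapAt ℝ x) ∘L D := by
      ext v
      exact congrArg (fun w => L (eM.continuousLinearMapAt ℝ x (D w))) (hid v)
    have e4 := e2.trans e3
    refine (congrArg (fun α => eM.continuousLinearMapAt ℝ x (D (π.sharp (u x) (α ∘L D)))) e1).trans ?_
    refine (congrArg (fun w => eM.continuousLinearMapAt ℝ x (D w)) (hid _)).symm.trans ?_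
    exact (congrArg (fun α => eM.continuousLinearMapAt ℝ x (D (eN.symmL ℝ (u x)
      (eN.continuousLinearMapAt ℝ (u x) (π.sharp (u x) α))))) e4).symm

end Bivectors
end QP

namespace QP
-- Descent of quasi-Poisson structures and actions
section Descent
variable {n : ℕ} {N : Type*} [TopologicalSpace N] [ChartedSpace (EuclideanSpace ℝ (Fin n)) N]
  [IsManifold (𝓡 n) ∞ N]
  {m : ℕ} {M : Type*} [TopologicalSpace M] [ChartedSpace (EuclideanSpace ℝ (Fin m)) M]
  [IsManifold (𝓡 m) ∞ M]
  {𝔤 : Type*} [LieRing 𝔤] [LieAlgebra ℝ 𝔤]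

omit [IsManifold (𝓡 n) ∞ N] [IsManifold (𝓡 m) ∞ M] in
theorem dfun_comp {s : N → M} {f : M → ℝ} {y : N}
    (hf : MDifferentiableAt (𝓡 m) 𝓘(ℝ, ℝ) f (s y)) (hs : MDifferentiableAt (𝓡 n) (𝓡 m) s y) :
    dfun (f ∘ s) y = (dfun f (s y)).comp (mfderiv (𝓡 n) (𝓡 m) s y) :=
  mfderiv_comp y hf hs

omit [IsManifold (𝓡 n) ∞ N] in
theorem dfun_congr {f g : N → ℝ} {y : N} (h : f =ᶠ[𝓝 y] g) :
    dfun (n := n) f y = dfun g y :=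
  h.mfderiv_eq (I := 𝓡 n) (I' := 𝓘(ℝ, ℝ))

namespace IsQPMap
variable {s : N → M} {ρ : GAction 𝔤 n N} {π : BivectorField n N} {ρM : GAction 𝔤 m M}
  {πM : BivectorField m M}

theorem mdifferentiableAt (h : IsQPMap s ρ π ρM πM) (y : N) :
    MDifferentiableAt (𝓡 n) (𝓡 m) s y := (h.smooth y).mdifferentiableAt (by simp)

theorem poisson_comp (h : IsQPMap s ρ π ρM πM) {f g : M → ℝ} {y : N}
    (hf : MDifferentiableAt (𝓡 m) 𝓘(ℝ, ℝ) f (s y)) (hg : MDifferentiableAt (𝓡 m) 𝓘(ℝ, ℝ) g (s y)) :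
    π.poisson (f ∘ s) (g ∘ s) y = πM.poisson f g (s y) := by
  rw [BivectorField.poisson, BivectorField.poisson, dfun_comp hf (h.mdifferentiableAt y),
    dfun_comp hg (h.mdifferentiableAt y), ← h.bivector]
  rfl

theorem deriv_comp (h : IsQPMap s ρ π ρM πM) {f : M → ℝ} {y : N}
    (hf : MDifferentiableAt (𝓡 m) 𝓘(ℝ, ℝ) f (s y)) (ξ : 𝔤) :
    ρ.deriv ξ (f ∘ s) y = ρM.deriv ξ f (s y) := by
  rw [GAction.deriv, GAction.deriv, dfun_comp hf (h.mdifferentiableAt y), ← h.equivariant]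
  rfl

theorem transpose_comp (h : IsQPMap s ρ π ρM πM) {f : M → ℝ} {y : N}
    (hf : MDifferentiableAt (𝓡 m) 𝓘(ℝ, ℝ) f (s y)) :
    ρ.transpose (dfun (f ∘ s) y) = ρM.transpose (dfun f (s y)) :=
  LinearMap.ext fun ξ => h.deriv_comp hf ξ

theorem eventually_mdifferentiableAt_comp (h : IsQPMap s ρ π ρM πM) {f : M → ℝ} {y : N}
    (hf : ContMDiffAt (𝓡 m) 𝓘(ℝ, ℝ) ∞ f (s y)) :
    ∀ᶠ z in 𝓝 y, MDifferentiableAt (𝓡 m) 𝓘(ℝ, ℝ) f (s z) :=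
  (h.smooth y).continuousAt.eventually (eventually_mdifferentiableAt hf)

/-- Iterated brackets differentiate a bracket, so the pointwise identity has to be upgraded to
germs; `deriv_comp_eventuallyEq` serves the same purpose. -/
theorem poisson_comp_eventuallyEq (h : IsQPMap s ρ π ρM πM) {f g : M → ℝ} {y : N}
    (hf : ContMDiffAt (𝓡 m) 𝓘(ℝ, ℝ) ∞ f (s y)) (hg : ContMDiffAt (𝓡 m) 𝓘(ℝ, ℝ) ∞ g (s y)) :
    π.poisson (f ∘ s) (g ∘ s) =ᶠ[𝓝 y] πM.poisson f g ∘ s := by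
  filter_upwards [h.eventually_mdifferentiableAt_comp hf,
    h.eventually_mdifferentiableAt_comp hg] with z hf hg
  exact h.poisson_comp hf hg

theorem deriv_comp_eventuallyEq (h : IsQPMap s ρ π ρM πM) {f : M → ℝ} {y : N}
    (hf : ContMDiffAt (𝓡 m) 𝓘(ℝ, ℝ) ∞ f (s y)) (ξ : 𝔤) :
    ρ.deriv ξ (f ∘ s) =ᶠ[𝓝 y] ρM.deriv ξ f ∘ s := by
  filter_upwards [h.eventually_mdifferentiableAt_comp hf] with z hf
  exact h.deriv_comp hf ξ

theorem _root_.QP.BivectorField.poisson_congr (π : BivectorField n N) {f f' g g' : N → ℝ} {y : N}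
    (hf : f =ᶠ[𝓝 y] f') (hg : g =ᶠ[𝓝 y] g') : π.poisson f g y = π.poisson f' g' y := by
  rw [BivectorField.poisson, dfun_congr hf, dfun_congr hg, BivectorField.poisson]

theorem _root_.QP.GAction.deriv_contMDiffAt (ρ : GAction 𝔤 n N) {f : N → ℝ} {y : N}
    (hf : ContMDiffAt (𝓡 n) 𝓘(ℝ, ℝ) ∞ f y) (ξ : 𝔤) :
    ContMDiffAt (𝓡 n) 𝓘(ℝ, ℝ) ∞ (ρ.deriv ξ f) y :=
  vfDeriv_contMDiffAt hf (ρ.smooth ξ y)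

/-- A quasi-Poisson structure descends along a surjective map. -/
theorem isQuasiPoisson [FiniteDimensional ℝ 𝔤] (h : IsQPMap s ρ π ρM πM) (hs : Function.Surjective s) {B : InvForm 𝔤}
    (hN : IsQuasiPoisson B ρ π) : IsQuasiPoisson B ρM πM where
  invariant x f g hf hg ξ := by
    -- The identity at `s y` is the one at `y` for the functions pulled back by `s`.
    obtain ⟨y, rfl⟩ := hs x
    have hd : ∀ {f : M → ℝ}, ContMDiffAt (𝓡 m) 𝓘(ℝ, ℝ) ∞ f (s y) →
      MDifferentiableAt (𝓡 m) 𝓘(ℝ, ℝ) f (s y) := fun hf => hf.mdifferentiableAt (by simp)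
    have key := hN.invariant y (f ∘ s) (g ∘ s) (hf.comp y (h.smooth y)) (hg.comp y (h.smooth y)) ξ
    rw [GAction.deriv, dfun_congr (h.poisson_comp_eventuallyEq hf hg),
      π.poisson_congr (h.deriv_comp_eventuallyEq hf ξ) (Filter.EventuallyEq.refl _ _),
      π.poisson_congr (Filter.EventuallyEq.refl _ _) (h.deriv_comp_eventuallyEq hg ξ),
      h.poisson_comp (hd (ρM.deriv_contMDiffAt hf ξ)) (hd hg),
      h.poisson_comp (hd hf) (hd (ρM.deriv_contMDiffAt hg ξ))] at key
    rw [← key]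
    exact (h.deriv_comp (hd (πM.poisson_contMDiffAt hf hg)) ξ).symm
  jacobi x f g k hf hg hk := by
    obtain ⟨y, rfl⟩ := hs x
    have hd : ∀ {f : M → ℝ}, ContMDiffAt (𝓡 m) 𝓘(ℝ, ℝ) ∞ f (s y) →
      MDifferentiableAt (𝓡 m) 𝓘(ℝ, ℝ) f (s y) := fun hf => hf.mdifferentiableAt (by simp)
    have hp : ∀ {f g k : M → ℝ}, ContMDiffAt (𝓡 m) 𝓘(ℝ, ℝ) ∞ f (s y) →
        ContMDiffAt (𝓡 m) 𝓘(ℝ, ℝ) ∞ g (s y) → ContMDiffAt (𝓡 m) 𝓘(ℝ, ℝ) ∞ k (s y) →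
        π.poisson (f ∘ s) (π.poisson (g ∘ s) (k ∘ s)) y = πM.poisson f (πM.poisson g k) (s y) := by
      intro f g k hf hg hk
      rw [π.poisson_congr (Filter.EventuallyEq.refl _ _) (h.poisson_comp_eventuallyEq hg hk),
        h.poisson_comp (hd hf) (hd (πM.poisson_contMDiffAt hg hk))]
    have key := hN.jacobi y (f ∘ s) (g ∘ s) (k ∘ s) (hf.comp y (h.smooth y))
      (hg.comp y (h.smooth y)) (hk.comp y (h.smooth y))
    rwa [hp hf hg hk, hp hg hk hf, hp hk hf hg, h.transpose_comp (hd hf), h.transpose_comp (hd hg),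
      h.transpose_comp (hd hk)] at key

end IsQPMap

omit [IsManifold (𝓡 m) ∞ M] in
theorem tangentBundle_mk_congr {x y : M} (h : x = y) (v : EuclideanSpace ℝ (Fin m)) :
    (⟨x, v⟩ : TangentBundle (𝓡 m) M) = ⟨y, v⟩ := by
  subst h; rfl

omit [IsManifold (𝓡 n) ∞ N] [IsManifold (𝓡 m) ∞ M] in
-- Differentiate `s ∘ u = id`. With `v` in the model space, no transport along `s (u x) = x` is
-- needed.
theorem mfderiv_section {s : N → M} {u : M → N}
    (hs : ContMDiff (𝓡 n) (𝓡 m) ∞ s) (hu : ContMDiff (𝓡 m) (𝓡 n) ∞ u) (hsu : ∀ x, s (u x) = x)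
    (x : M) (v : EuclideanSpace ℝ (Fin m)) :
    mfderiv (𝓡 n) (𝓡 m) s (u x) (mfderiv (𝓡 m) (𝓡 n) u x v) = v := by
  have h := mfderiv_comp x ((hs (u x)).mdifferentiableAt (by simp))
    ((hu x).mdifferentiableAt (by simp))
  have h1 : s ∘ u = id := funext hsu
  rw [h1, mfderiv_id] at h
  exact (DFunLike.congr_fun h v).symm

/-- A Lie algebra action tangent to the image of a section `u` of `s` induces an action on the
target of `s`. -/
noncomputable def GAction.restrict (ρ : GAction 𝔤 n N) {s : N → M} {u : M → N}
    (hs : ContMDiff (𝓡 n) (𝓡 m) ∞ s) (hu : ContMDiff (𝓡 m) (𝓡 n) ∞ u) (hsu : ∀ x, s (u x) = x)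
    (h : ∀ ξ x, mfderiv (𝓡 m) (𝓡 n) u x (mfderiv (𝓡 n) (𝓡 m) s (u x) (ρ.act (u x) ξ)) =
      ρ.act (u x) ξ) : GAction 𝔤 m M :=
  have hsm : ∀ ξ, SmoothVF fun x : M =>
      (mfderiv (𝓡 n) (𝓡 m) s (u x) (ρ.act (u x) ξ) : EuclideanSpace ℝ (Fin m)) := fun ξ => by
    have h1 := ((hs.contMDiff_tangentMap (m := ∞) le_rfl).comp (ρ.smooth ξ)).comp hu
    have h2 : (fun x : M => (⟨x, (mfderiv (𝓡 n) (𝓡 m) s (u x) (ρ.act (u x) ξ) :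
        EuclideanSpace ℝ (Fin m))⟩ : TangentBundle (𝓡 m) M)) =
        (tangentMap (𝓡 n) (𝓡 m) s ∘ fun y => ⟨y, ρ.act y ξ⟩) ∘ u :=
      funext fun x => (tangentBundle_mk_congr (hsu x) _).symm
    rw [← h2] at h1
    exact h1
  { act := fun x =>
      let D : TangentSpace (𝓡 n) (u x) →L[ℝ] TangentSpace (𝓡 m) x := mfderiv (𝓡 n) (𝓡 m) s (u x)
      (D : TangentSpace (𝓡 n) (u x) →ₗ[ℝ] TangentSpace (𝓡 m) x) ∘ₗ ρ.act (u x)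
    smooth := hsm
    lie := fun ξ η x => by
      -- By `h` the induced fields are `u`-related to those of `ρ`, hence so are their brackets;
      -- applying `ds` then undoes `du`.
      have h1 := mfderiv_mlieBracket_of_related hu (hsm ξ) (hsm η) (ρ.smooth ξ) (ρ.smooth η)
        (h ξ) (h η) x
      rw [← ρ.lie ξ η (u x)] at h1
      have h2 := mfderiv_section hs hu hsu x (VectorField.mlieBracket (𝓡 m)
        (fun x => mfderiv (𝓡 n) (𝓡 m) s (u x) (ρ.act (u x) ξ))
        (fun x => mfderiv (𝓡 n) (𝓡 m) s (u x) (ρ.act (u x) η)) x)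
      exact (congrArg (mfderiv (𝓡 n) (𝓡 m) s (u x)) h1.symm).trans h2 }

end Descent
end QP

namespace QP

/-! ### Contractions with dual bases -/

section Quadratic
variable {𝔤 : Type*} [LieRing 𝔤] [LieAlgebra ℝ 𝔤] [FiniteDimensional ℝ 𝔤]

namespace InvForm

theorem form_sharp (B : InvForm 𝔤) (a : 𝔤 →ₗ[ℝ] ℝ) (ξ : 𝔤) :
    B.form (B.sharp a) ξ = a ξ :=
  LinearMap.BilinForm.apply_toDual_symm_apply (hB := B.nondeg) a ξ

theorem sharp_form (B : InvForm 𝔤) (ξ : 𝔤) : B.sharp (B.form ξ) = ξ :=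
  (LinearEquiv.symm_apply_apply (B.form.toDual B.nondeg) ξ)

theorem sum_form_lo_smul_up (B : InvForm 𝔤) (ξ : 𝔤) : ∑ i, B.form ξ (B.lo i) • B.up i = ξ := by
  conv_rhs => rw [← B.up.sum_repr ξ]
  exact Finset.sum_congr rfl fun i _ => by
    rw [up, LinearMap.BilinForm.dualBasis_repr_apply]

theorem sum_form_up_smul_lo (B : InvForm 𝔤) (ξ : 𝔤) : ∑ i, B.form ξ (B.up i) • B.lo i = ξ := by
  have h : ∀ i, B.form ξ (B.up i) = B.lo.repr ξ i := fun i => by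
    conv_lhs => rw [← B.lo.sum_repr ξ]
    have hd : ∀ j, B.form (B.lo j) (B.up i) = if j = i then 1 else 0 := fun j => by
      rw [B.symm]
      exact LinearMap.BilinForm.apply_dualBasis_left B.nondeg B.lo i j
    simp only [map_sum, LinearMap.sum_apply, map_smul, LinearMap.smul_apply, hd, smul_eq_mul,
      mul_ite, mul_one, mul_zero, Finset.sum_ite_eq', Finset.mem_univ, if_true]
  simp only [h, B.lo.sum_repr]

/-- Expand `B.sharp a` in the basis. With `sum_lo_mul_up`, this turns fusion terms into the
basis-free pairing on `𝔤*`, whichever factor carries the dual basis. -/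
theorem sum_up_mul_lo (B : InvForm 𝔤) (a b : 𝔤 →ₗ[ℝ] ℝ) :
    ∑ i, a (B.up i) * b (B.lo i) = b (B.sharp a) := by
  conv_rhs => rw [← B.sum_form_up_smul_lo (B.sharp a)]
  simp [form_sharp]

theorem sum_lo_mul_up (B : InvForm 𝔤) (a b : 𝔤 →ₗ[ℝ] ℝ) :
    ∑ i, a (B.lo i) * b (B.up i) = b (B.sharp a) := by
  conv_rhs => rw [← B.sum_form_lo_smul_up (B.sharp a)]
  simp [form_sharp]

end InvForm
end Quadratic

/-! ### Pulled-back covectors and velocities of curves -/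

section Pullback
variable {n : ℕ} {N : Type*} [TopologicalSpace N] [ChartedSpace (EuclideanSpace ℝ (Fin n)) N]
  {m : ℕ} {M : Type*} [TopologicalSpace M] [ChartedSpace (EuclideanSpace ℝ (Fin m)) M]

/-- The pull-back by `f` of a covector, where all the tangent spaces of the target are identified with
the model space. -/
noncomputable def pullCovector (f : N → M) (y : N) (β : EuclideanSpace ℝ (Fin m) →L[ℝ] ℝ) :
    TangentSpace (𝓡 n) y →L[ℝ] ℝ :=
  let D : TangentSpace (𝓡 n) y →L[ℝ] EuclideanSpace ℝ (Fin m) := mfderiv (𝓡 n) (𝓡 m) f y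
  β.comp D

theorem pullCovector_apply (f : N → M) (y : N) (β : EuclideanSpace ℝ (Fin m) →L[ℝ] ℝ)
    (v : TangentSpace (𝓡 n) y) : pullCovector f y β v = β (mfderiv (𝓡 n) (𝓡 m) f y v) := rfl

theorem tangentMap_comp_curve {f : N → M} (hf : ContMDiff (𝓡 n) (𝓡 m) ∞ f) {c : ℝ → N}
    (hc : ContMDiff 𝓘(ℝ, ℝ) (𝓡 n) ∞ c) {y : N} {v : TangentSpace (𝓡 n) y}
    (h : tangentMap 𝓘(ℝ, ℝ) (𝓡 n) c ⟨0, (1 : ℝ)⟩ = ⟨y, v⟩) :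
    tangentMap 𝓘(ℝ, ℝ) (𝓡 m) (f ∘ c) ⟨0, (1 : ℝ)⟩ = ⟨f y, mfderiv (𝓡 n) (𝓡 m) f y v⟩ := by
  rw [tangentMap_comp_at _ ((hf _).mdifferentiableAt (by simp)) ((hc _).mdifferentiableAt (by simp)),
    h]
  rfl

theorem tangentBundle_mk_snd {x y : M} {v : TangentSpace (𝓡 m) x} {w : TangentSpace (𝓡 m) y}
    (h : (⟨x, v⟩ : TangentBundle (𝓡 m) M) = ⟨y, w⟩) :
    (v : EuclideanSpace ℝ (Fin m)) = (w : EuclideanSpace ℝ (Fin m)) :=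
  congrArg (fun p : TangentBundle (𝓡 m) M => (p.2 : EuclideanSpace ℝ (Fin m))) h

end Pullback

/-! ### Consequences of fusion multiplicativity -/

section Groupoids
variable {n m : ℕ} {Γ M : Type*}
    [TopologicalSpace Γ] [ChartedSpace (EuclideanSpace ℝ (Fin n)) Γ] [IsManifold (𝓡 n) ∞ Γ]
    [TopologicalSpace M] [ChartedSpace (EuclideanSpace ℝ (Fin m)) M] [IsManifold (𝓡 m) ∞ M]

namespace LieGroupoid
variable (𝒢 : LieGroupoid n m Γ M)

theorem mul_unit_unit (x : M) : 𝒢.mul (𝒢.u x) (𝒢.u x) = 𝒢.u x := by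
  have h := 𝒢.unit_mul (𝒢.u x)
  rwa [𝒢.t_unit] at h

theorem contMDiff_mul_curves {c₁ c₂ : ℝ → Γ} (h₁ : ContMDiff 𝓘(ℝ, ℝ) (𝓡 n) ∞ c₁)
    (h₂ : ContMDiff 𝓘(ℝ, ℝ) (𝓡 n) ∞ c₂) (h : ∀ τ, 𝒢.s (c₁ τ) = 𝒢.t (c₂ τ)) :
    ContMDiff 𝓘(ℝ, ℝ) (𝓡 n) ∞ fun τ => 𝒢.mul (c₁ τ) (c₂ τ) :=
  𝒢.smooth_mul.comp_contMDiff (h₁.prodMk h₂) h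

namespace TangentGraph
variable {𝒢} {g h : Γ} {v : TangentSpace (𝓡 n) g} {w : TangentSpace (𝓡 n) h}
  {z : TangentSpace (𝓡 n) (𝒢.mul g h)}

/-- Differentiate `s(c₁) = t(c₂)` along the curves; `t_mul` and `s_mul` arise likewise from `t(c₁c₂)
= t(c₁)` and `s(c₁c₂) = s(c₂)`. A full description of the tangent space of the graph is never
needed. -/
theorem s_left (H : 𝒢.TangentGraph g h v w z) :
    (mfderiv (𝓡 n) (𝓡 m) 𝒢.s g v : EuclideanSpace ℝ (Fin m)) = mfderiv (𝓡 n) (𝓡 m) 𝒢.t h w := by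
  obtain ⟨c₁, c₂, h₁, h₂, hc, e₁, e₂, -⟩ := H
  have a := tangentMap_comp_curve 𝒢.smooth_s h₁ e₁
  have b := tangentMap_comp_curve 𝒢.smooth_t h₂ e₂
  have hc' : 𝒢.s ∘ c₁ = 𝒢.t ∘ c₂ := funext hc
  rw [hc', b] at a
  exact (tangentBundle_mk_snd a).symm

theorem t_mul (H : 𝒢.TangentGraph g h v w z) :
    (mfderiv (𝓡 n) (𝓡 m) 𝒢.t (𝒢.mul g h) z : EuclideanSpace ℝ (Fin m)) =
      mfderiv (𝓡 n) (𝓡 m) 𝒢.t g v := by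
  obtain ⟨c₁, c₂, h₁, h₂, hc, e₁, -, e₃⟩ := H
  have a := tangentMap_comp_curve 𝒢.smooth_t h₁ e₁
  have b := tangentMap_comp_curve 𝒢.smooth_t (𝒢.contMDiff_mul_curves h₁ h₂ hc) e₃
  have hc' : 𝒢.t ∘ (fun τ => 𝒢.mul (c₁ τ) (c₂ τ)) = 𝒢.t ∘ c₁ :=
    funext fun τ => 𝒢.t_mul _ _ (hc τ)
  rw [hc', a] at b
  exact (tangentBundle_mk_snd b).symm

theorem s_mul (H : 𝒢.TangentGraph g h v w z) :
    (mfderiv (𝓡 n) (𝓡 m) 𝒢.s (𝒢.mul g h) z : EuclideanSpace ℝ (Fin m)) =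
      mfderiv (𝓡 n) (𝓡 m) 𝒢.s h w := by
  obtain ⟨c₁, c₂, h₁, h₂, hc, -, e₂, e₃⟩ := H
  have a := tangentMap_comp_curve 𝒢.smooth_s h₂ e₂
  have b := tangentMap_comp_curve 𝒢.smooth_s (𝒢.contMDiff_mul_curves h₁ h₂ hc) e₃
  have hc' : 𝒢.s ∘ (fun τ => 𝒢.mul (c₁ τ) (c₂ τ)) = 𝒢.s ∘ c₂ :=
    funext fun τ => 𝒢.s_mul _ _ (hc τ)
  rw [hc', a] at b
  exact (tangentBundle_mk_snd b).symm

end TangentGraph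

/-- Dual to `TangentGraph.s_left`; the next two are dual to `t_mul` and `s_mul`. Pairs of these
covectors are the test inputs for coisotropy. -/
theorem conormal_source_target (g h : Γ) (β : EuclideanSpace ℝ (Fin m) →L[ℝ] ℝ) :
    𝒢.Conormal g h (pullCovector 𝒢.s g β) (-pullCovector 𝒢.t h β) 0 := by
  intro v w z H
  have := congrArg β H.s_left
  rw [neg_apply, pullCovector_apply, pullCovector_apply,
    zero_apply]
  linarith

theorem conormal_target (g h : Γ) (β : EuclideanSpace ℝ (Fin m) →L[ℝ] ℝ) :
    𝒢.Conormal g h (pullCovector 𝒢.t g β) 0 (-pullCovector 𝒢.t (𝒢.mul g h) β) := by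
  intro v w z H
  have := congrArg β H.t_mul
  rw [neg_apply, pullCovector_apply, pullCovector_apply,
    zero_apply]
  linarith

theorem conormal_source (g h : Γ) (β : EuclideanSpace ℝ (Fin m) →L[ℝ] ℝ) :
    𝒢.Conormal g h 0 (pullCovector 𝒢.s h β) (-pullCovector 𝒢.s (𝒢.mul g h) β) := by
  intro v w z H
  have := congrArg β H.s_mul
  rw [neg_apply, pullCovector_apply, pullCovector_apply,
    zero_apply]
  linarith

variable {𝒢}

/-- The base field is given only by existence; its value at a unit pins it down as `ds` of the
restriction of `X` to the units. -/
theorem IsInfAut.mfderiv_s {X : ∀ g : Γ, TangentSpace (𝓡 n) g} (h : 𝒢.IsInfAut X) (g : Γ) :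
    (mfderiv (𝓡 n) (𝓡 m) 𝒢.s g (X g) : EuclideanSpace ℝ (Fin m)) =
      mfderiv (𝓡 n) (𝓡 m) 𝒢.s (𝒢.u (𝒢.s g)) (X (𝒢.u (𝒢.s g))) := by
  obtain ⟨⟨X₀, hs, -, -⟩, -⟩ := h
  have : (X₀ (𝒢.s (𝒢.u (𝒢.s g))) : EuclideanSpace ℝ (Fin m)) = X₀ (𝒢.s g) := by rw [𝒢.s_unit]
  exact (hs g).trans (this.symm.trans (hs (𝒢.u (𝒢.s g))).symm)

theorem IsInfAut.mfderiv_t {X : ∀ g : Γ, TangentSpace (𝓡 n) g} (h : 𝒢.IsInfAut X) (g : Γ) :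
    (mfderiv (𝓡 n) (𝓡 m) 𝒢.t g (X g) : EuclideanSpace ℝ (Fin m)) =
      mfderiv (𝓡 n) (𝓡 m) 𝒢.s (𝒢.u (𝒢.t g)) (X (𝒢.u (𝒢.t g))) := by
  obtain ⟨⟨X₀, hs, ht, -⟩, -⟩ := h
  have : (X₀ (𝒢.s (𝒢.u (𝒢.t g))) : EuclideanSpace ℝ (Fin m)) = X₀ (𝒢.t g) := by rw [𝒢.s_unit]
  exact (ht g).trans (this.symm.trans (hs (𝒢.u (𝒢.t g))).symm)

theorem IsInfAut.mfderiv_u {X : ∀ g : Γ, TangentSpace (𝓡 n) g} (h : 𝒢.IsInfAut X) (x : M) :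
    mfderiv (𝓡 m) (𝓡 n) 𝒢.u x (mfderiv (𝓡 n) (𝓡 m) 𝒢.s (𝒢.u x) (X (𝒢.u x))) = X (𝒢.u x) := by
  obtain ⟨⟨X₀, hs, ht, hu⟩, -⟩ := h
  refine Eq.trans ?_ (hu x)
  have : (X₀ (𝒢.s (𝒢.u x)) : EuclideanSpace ℝ (Fin m)) = X₀ x := by rw [𝒢.s_unit]
  exact congrArg (mfderiv (𝓡 m) (𝓡 n) 𝒢.u x) ((hs _).trans this)

end LieGroupoid

variable {𝔤 : Type*} [LieRing 𝔤] [LieAlgebra ℝ 𝔤] [FiniteDimensional ℝ 𝔤]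
  {𝒢 : LieGroupoid n m Γ M} {B : InvForm 𝔤} {ρ : GAction 𝔤 n Γ} {π : BivectorField n Γ}

omit [FiniteDimensional ℝ 𝔤] in
theorem GAction.transpose_apply (ρ : GAction 𝔤 n Γ) {g : Γ} (α : TangentSpace (𝓡 n) g →L[ℝ] ℝ)
    (ξ : 𝔤) : ρ.transpose α ξ = α (ρ.act g ξ) := rfl

omit [FiniteDimensional ℝ 𝔤] in
theorem GAction.transpose_neg (ρ : GAction 𝔤 n Γ) {g : Γ} (α : TangentSpace (𝓡 n) g →L[ℝ] ℝ) :
    ρ.transpose (-α) = -ρ.transpose α := rfl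

omit [FiniteDimensional ℝ 𝔤] in
theorem GAction.transpose_zero (ρ : GAction 𝔤 n Γ) {g : Γ} :
    ρ.transpose (0 : TangentSpace (𝓡 n) g →L[ℝ] ℝ) = 0 := rfl

omit [FiniteDimensional ℝ 𝔤] in
-- At a unit, `s` and `t` project `ρ(ξ)` to the same vector, the value of one base field.
theorem transpose_target_unit (hρ : ∀ ξ, 𝒢.IsInfAut fun g => ρ.act g ξ) (x : M)
    (β : EuclideanSpace ℝ (Fin m) →L[ℝ] ℝ) :
    ρ.transpose (pullCovector 𝒢.t (𝒢.u x) β) = ρ.transpose (pullCovector 𝒢.s (𝒢.u x) β) := by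
  ext ξ
  have h := (hρ ξ).mfderiv_t (𝒢.u x)
  rw [𝒢.t_unit] at h
  exact congrArg β h

namespace IsFusionMultiplicative

/-- Multiply `g⁻¹` by `g`, so that the product is a unit. The first entry of `(0, s*β, -s*β)` is
zero, which removes both the first copy of `π` and the fusion term. For `target_target` the product
is `g g⁻¹`. -/
theorem source_source (H : IsFusionMultiplicative 𝒢 B ρ π) (g : Γ)
    (β β' : EuclideanSpace ℝ (Fin m) →L[ℝ] ℝ) :
    pullCovector 𝒢.s g β' (π.sharp g (pullCovector 𝒢.s g β)) =
      pullCovector 𝒢.s (𝒢.u (𝒢.s g)) β' (π.sharp (𝒢.u (𝒢.s g))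
        (pullCovector 𝒢.s (𝒢.u (𝒢.s g)) β)) := by
  have h := H (𝒢.inv g) g (𝒢.s_inv g) _ _ _ _ _ _ (𝒢.conormal_source _ _ β)
    (𝒢.conormal_source _ _ β')
  rw [𝒢.inv_mul] at h
  simp at h
  linarith

theorem target_target (H : IsFusionMultiplicative 𝒢 B ρ π) (g : Γ)
    (β β' : EuclideanSpace ℝ (Fin m) →L[ℝ] ℝ) :
    pullCovector 𝒢.t g β' (π.sharp g (pullCovector 𝒢.t g β)) =
      pullCovector 𝒢.t (𝒢.u (𝒢.t g)) β' (π.sharp (𝒢.u (𝒢.t g))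
        (pullCovector 𝒢.t (𝒢.u (𝒢.t g)) β)) := by
  have h := H g (𝒢.inv g) (𝒢.t_inv g).symm _ _ _ _ _ _ (𝒢.conormal_target _ _ β)
    (𝒢.conormal_target _ _ β')
  rw [𝒢.mul_inv] at h
  simp at h
  linarith

/-- Test on `(s*β, -t*β, 0)`: the product does not contribute, and the two halves of the fusion term
cancel because `ρ*` does not distinguish `s*β` from `t*β` at a unit. -/
theorem target_target_unit (H : IsFusionMultiplicative 𝒢 B ρ π)
    (hρ : ∀ ξ, 𝒢.IsInfAut fun g => ρ.act g ξ) (x : M) (β β' : EuclideanSpace ℝ (Fin m) →L[ℝ] ℝ) :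
    pullCovector 𝒢.t (𝒢.u x) β' (π.sharp (𝒢.u x) (pullCovector 𝒢.t (𝒢.u x) β)) =
      - pullCovector 𝒢.s (𝒢.u x) β' (π.sharp (𝒢.u x) (pullCovector 𝒢.s (𝒢.u x) β)) := by
  have h := H (𝒢.u x) (𝒢.u x) (by rw [𝒢.s_unit, 𝒢.t_unit]) _ _ _ _ _ _
    (𝒢.conormal_source_target _ _ β) (𝒢.conormal_source_target _ _ β')
  simp only [← ρ.transpose_apply, Finset.sum_sub_distrib, B.sum_lo_mul_up, B.sum_up_mul_lo,
    ρ.transpose_neg, transpose_target_unit hρ] at h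
  simp at h
  linarith

/-- Pairing `(t*β, 0, -t*β)` with `(0, s*β', -s*β')` leaves only the product term and one half of
the fusion term. This is the source of the correction relating `d_{A*}` to `𝒟`. -/
theorem target_source_unit (H : IsFusionMultiplicative 𝒢 B ρ π)
    (hρ : ∀ ξ, 𝒢.IsInfAut fun g => ρ.act g ξ) (x : M) (β β' : EuclideanSpace ℝ (Fin m) →L[ℝ] ℝ) :
    pullCovector 𝒢.s (𝒢.u x) β' (π.sharp (𝒢.u x) (pullCovector 𝒢.t (𝒢.u x) β)) =
      - (2⁻¹ * ρ.transpose (pullCovector 𝒢.s (𝒢.u x) β')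
          (B.sharp (ρ.transpose (pullCovector 𝒢.s (𝒢.u x) β)))) := by
  have h := H (𝒢.u x) (𝒢.u x) (by rw [𝒢.s_unit, 𝒢.t_unit]) _ _ _ _ _ _
    (𝒢.conormal_target _ _ β) (𝒢.conormal_source _ _ β')
  rw [𝒢.mul_unit_unit] at h
  simp only [← ρ.transpose_apply, transpose_target_unit hρ, ρ.transpose_zero] at h
  simp [B.sum_up_mul_lo] at h
  linarith


end IsFusionMultiplicative

end Groupoids
end QP

namespace QP

/-! ### Invariant vector fields at the identity -/

section LieGroups
variable {k : ℕ} {G : Type*} [TopologicalSpace G] [ChartedSpace (EuclideanSpace ℝ (Fin k)) G]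
  [Group G] [LieGroup (𝓡 k) ∞ G]

omit [Group G] [LieGroup (𝓡 k) ∞ G] in
theorem mfderiv_of_eq_id {φ : G → G} (hφ : φ = id) (g : G) (v : EuclideanSpace ℝ (Fin k)) :
    (mfderiv (𝓡 k) (𝓡 k) φ g v : EuclideanSpace ℝ (Fin k)) = v := by
  subst hφ
  exact DFunLike.congr_fun (mfderiv_id (I := 𝓡 k) (x := g)) v

omit [LieGroup (𝓡 k) ∞ G] in
-- Translation by the identity element is the identity map. The point is a variable because it will
-- be `Φ` of a unit, on which the tangent space depends.
theorem leftVF_of_eq_one (ξ : GroupLieAlgebra (𝓡 k) G) {g : G} (hg : g = 1) :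
    (leftVF ξ g : EuclideanSpace ℝ (Fin k)) = ξ := by
  subst hg
  exact mfderiv_of_eq_id (funext one_mul) 1 ξ

omit [LieGroup (𝓡 k) ∞ G] in
theorem rightVF_of_eq_one (ξ : GroupLieAlgebra (𝓡 k) G) {g : G} (hg : g = 1) :
    (rightVF ξ g : EuclideanSpace ℝ (Fin k)) = ξ := by
  subst hg
  exact mfderiv_of_eq_id (funext mul_one) 1 ξ

theorem half_smul_add_self {E : Type*} [AddCommGroup E] [Module ℝ E] {v w η : E} (hv : v = η)
    (hw : w = η) : (2⁻¹ : ℝ) • (v + w) = η := by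
  subst hv; subst hw
  rw [← two_smul ℝ, smul_smul]
  norm_num

end LieGroups

/-! ### The anchor of the bialgebroid at the units -/

section Correspondence
variable {k m n r : ℕ}
  {G : Type*} [TopologicalSpace G] [ChartedSpace (EuclideanSpace ℝ (Fin k)) G]
  [Group G] [LieGroup (𝓡 k) ∞ G]
  {Γ M : Type*}
  [TopologicalSpace Γ] [ChartedSpace (EuclideanSpace ℝ (Fin n)) Γ] [IsManifold (𝓡 n) ∞ Γ]
  [TopologicalSpace M] [ChartedSpace (EuclideanSpace ℝ (Fin m)) M] [IsManifold (𝓡 m) ∞ M]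
  {A : M → Type*}
  [TopologicalSpace (Bundle.TotalSpace (EuclideanSpace ℝ (Fin r)) A)]
  [∀ x, TopologicalSpace (A x)] [∀ x, AddCommGroup (A x)] [∀ x, Module ℝ (A x)]
  [FiberBundle (EuclideanSpace ℝ (Fin r)) A] [VectorBundle ℝ (EuclideanSpace ℝ (Fin r)) A]
  {B : InvForm (GroupLieAlgebra (𝓡 k) G)} {𝒢 : LieGroupoid n m Γ M}
  {ρ : GAction (GroupLieAlgebra (𝓡 k) G) n Γ} {π : BivectorField n Γ} {Φ : Γ → G}
  {𝒜 : QPBialgebroid B m r A}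

/-- A unit is idempotent, and `1` is the only idempotent of a group. -/
theorem IsHamQPGroupoid.map_unit (hΓ : IsHamQPGroupoid 𝒢 B ρ π Φ) (x : M) : Φ (𝒢.u x) = 1 := by
  have h := hΓ.map_mul (𝒢.u x) (𝒢.u x) (by rw [𝒢.s_unit, 𝒢.t_unit])
  rw [𝒢.mul_unit_unit] at h
  exact left_eq_mul.mp h

/-- The covector `v ↦ B(ξ, dΦ(v))` at a unit is mapped to `ρ(ξ)` by `π♯` and to `0` by
`ρ*`. -/
theorem Correspondence.sharp_ρ (hΓ : IsHamQPGroupoid 𝒢 B ρ π Φ) (C : Correspondence 𝒢 ρ π Φ 𝒜)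
    (ξ : GroupLieAlgebra (𝓡 k) G) (x : M) :
    π.sharp (𝒢.u x) (C.κ x (𝒜.ρ ξ x)) = ρ.act (𝒢.u x) ξ ∧
      ρ.transpose (C.κ x (𝒜.ρ ξ x)) = 0 := by
  have h1 := hΓ.map_unit x
  let a : EuclideanSpace ℝ (Fin k) →L[ℝ] ℝ :=
    LinearMap.toContinuousLinearMap (E := EuclideanSpace ℝ (Fin k)) (B.form ξ)
  let D : TangentSpace (𝓡 n) (𝒢.u x) →L[ℝ] EuclideanSpace ℝ (Fin k) :=
    mfderiv (𝓡 n) (𝓡 k) Φ (𝒢.u x)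
  -- As `Φ (u x) = 1`, the vector `dΦ(v)` is itself the element of `𝔤` in the moment condition.
  have hκ : C.κ x (𝒜.ρ ξ x) = a.comp D := by
    ext v
    exact C.moment x ξ (D v) v (leftVF_of_eq_one (D v) h1).symm
  constructor
  · have h2 := hΓ.momentMap.moment (𝒢.u x) a (B.form ξ) fun η => by
      have h3 : ((2⁻¹ : ℝ) • (leftVF η (Φ (𝒢.u x)) + rightVF η (Φ (𝒢.u x))) :
          EuclideanSpace ℝ (Fin k)) = η :=
        half_smul_add_self (E := EuclideanSpace ℝ (Fin k)) (leftVF_of_eq_one η h1)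
          (rightVF_of_eq_one η h1)
      exact (congrArg (B.form ξ) h3).symm
    rw [B.sharp_form] at h2
    rw [hκ]
    exact h2
  · ext η
    have h4 : D (ρ.act (𝒢.u x) η) = 0 := by
      refine (hΓ.momentMap.equivariant (𝒢.u x) η).trans ?_
      have h5 : (leftVF η (Φ (𝒢.u x)) : EuclideanSpace ℝ (Fin k)) = rightVF η (Φ (𝒢.u x)) := by
        rw [leftVF_of_eq_one η h1, rightVF_of_eq_one η h1]
      exact sub_eq_zero_of_eq h5
    rw [hκ, ρ.transpose_apply]
    change a (D (ρ.act (𝒢.u x) η)) = 0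
    rw [h4, map_zero]

/-- By `sharp_ρ` the correction `½ ρ ρ*` in the anchor vanishes on this covector, and `π♯` gives
`ρ(ξ)`. -/
theorem Correspondence.mfderiv_u_anchor_ρ (hΓ : IsHamQPGroupoid 𝒢 B ρ π Φ)
    (C : Correspondence 𝒢 ρ π Φ 𝒜) (ξ : GroupLieAlgebra (𝓡 k) G) (x : M) :
    mfderiv (𝓡 m) (𝓡 n) 𝒢.u x (𝒜.anchorMap x (𝒜.ρ ξ x)) = ρ.act (𝒢.u x) ξ := by
  obtain ⟨h1, h2⟩ := C.sharp_ρ hΓ ξ x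
  rw [C.anchor, h1, h2, map_zero, smul_zero, map_zero, add_zero]

/-- The anchor of `A` on the image of `𝔤` is the push-forward of `ρ` by the source map. -/
theorem Correspondence.anchor_ρ (hΓ : IsHamQPGroupoid 𝒢 B ρ π Φ)
    (C : Correspondence 𝒢 ρ π Φ 𝒜) (ξ : GroupLieAlgebra (𝓡 k) G) (x : M) :
    (mfderiv (𝓡 n) (𝓡 m) 𝒢.s (𝒢.u x) (ρ.act (𝒢.u x) ξ) : EuclideanSpace ℝ (Fin m)) =
      𝒜.anchorMap x (𝒜.ρ ξ x) := by
  rw [← C.mfderiv_u_anchor_ρ hΓ]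
  exact mfderiv_section 𝒢.smooth_s 𝒢.smooth_u 𝒢.s_unit x _

/-- The section `d_{A*} f` of `A`. -/
theorem QPBialgebroid.ιInv_dDual (𝒜 : QPBialgebroid B m r A) (f : Fn m M) (x : M) :
    ExteriorAlgebra.ιInv (𝒜.dDual (algebraMap (Fn m M) (MSec m r A) f)) x =
      𝒜.𝒟fun f x + (2⁻¹ : ℝ) • ∑ i, dfun f x (𝒜.anchorMap x (𝒜.ρ (B.lo i) x)) • 𝒜.ρ (B.up i) x := by
  have h : ExteriorAlgebra.ιInv (𝒜.dDual (algebraMap (Fn m M) (MSec m r A) f)) =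
      𝒜.𝒟fun f + (2⁻¹ : ℝ) • ∑ i, 𝒜.anchor (𝒜.ρ (B.lo i)) f • 𝒜.ρ (B.up i) := by
    rw [QPBialgebroid.dDual, map_add, LinearMap.map_smul_of_tower, map_sum]
    refine congrArg₂ _ rfl (congrArg _ (Finset.sum_congr rfl fun i _ => ?_))
    -- The bracket `[ρ(e_i), f]` is a function; moved to the front, it becomes a scalar multiplying
    -- the section `ρ(e^i)`.
    rw [LieRinehart.schouten_ι, LieRinehart.lieDer_fun, ← Algebra.commutes, ← Algebra.smul_def,
      map_smul, ExteriorAlgebra.ι_leftInverse]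
  rw [h]
  have hs : ∀ (X : Fin (Module.finrank ℝ (GroupLieAlgebra (𝓡 k) G)) → Sec m r A),
      (∑ i, X i : Sec m r A) x = ∑ i, X i x := fun X => by
    rw [← Finset.sum_apply]
    exact congrFun (map_sum (ContMDiffSection.coeAddHom (𝓡 m) (EuclideanSpace ℝ (Fin r)) ∞ A)
      X Finset.univ) x
  rw [ContMDiffSection.coe_add, Pi.add_apply, ContMDiffSection.coe_smul, Pi.smul_apply, hs]
  refine congrArg₂ _ rfl (congrArg _ (Finset.sum_congr rfl fun i _ => ?_))
  rw [← 𝒜.anchor_eq]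
  rfl

/-- `d_{A*} f` is the restriction of `d(s* f - t* f)` to the units. -/
theorem Correspondence.κ_dDual (C : Correspondence 𝒢 ρ π Φ 𝒜) (f : Fn m M) (x : M) :
    C.κ x (ExteriorAlgebra.ιInv (𝒜.dDual (algebraMap (Fn m M) (MSec m r A) f)) x) =
      pullCovector 𝒢.s (𝒢.u x) (dfun (n := m) f x) - pullCovector 𝒢.t (𝒢.u x) (dfun (n := m) f x) := by
  set a := ExteriorAlgebra.ιInv (𝒜.dDual (algebraMap (Fn m M) (MSec m r A) f)) x
  have hs : ∀ w : EuclideanSpace ℝ (Fin m), (mfderiv (𝓡 n) (𝓡 m) 𝒢.s (𝒢.u x)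
      (mfderiv (𝓡 m) (𝓡 n) 𝒢.u x w) : EuclideanSpace ℝ (Fin m)) = w :=
    mfderiv_section 𝒢.smooth_s 𝒢.smooth_u 𝒢.s_unit x
  have ht : ∀ w : EuclideanSpace ℝ (Fin m), (mfderiv (𝓡 n) (𝓡 m) 𝒢.t (𝒢.u x)
      (mfderiv (𝓡 m) (𝓡 n) 𝒢.u x w) : EuclideanSpace ℝ (Fin m)) = w :=
    mfderiv_section 𝒢.smooth_t 𝒢.smooth_u 𝒢.t_unit x
  have hu : ∀ w : EuclideanSpace ℝ (Fin m), C.κ x a (mfderiv (𝓡 m) (𝓡 n) 𝒢.u x w) = 0 :=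
    (C.κ_range x (C.κ x a)).1 ⟨a, rfl⟩
  let S : TangentSpace (𝓡 n) (𝒢.u x) →L[ℝ] EuclideanSpace ℝ (Fin m) :=
    mfderiv (𝓡 n) (𝓡 m) 𝒢.s (𝒢.u x)
  let T : TangentSpace (𝓡 n) (𝒢.u x) →L[ℝ] EuclideanSpace ℝ (Fin m) :=
    mfderiv (𝓡 n) (𝓡 m) 𝒢.t (𝒢.u x)
  let U : EuclideanSpace ℝ (Fin m) →L[ℝ] TangentSpace (𝓡 n) (𝒢.u x) :=
    mfderiv (𝓡 m) (𝓡 n) 𝒢.u x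
  let df : EuclideanSpace ℝ (Fin m) →L[ℝ] ℝ := dfun (n := m) f x
  have hdf : (dfun f (𝒢.s (𝒢.u x)) : EuclideanSpace ℝ (Fin m) →L[ℝ] ℝ) = df := by
    rw [𝒢.s_unit]
  ext v
  -- Split `v` into a part in `ker dt`, where `anchor_dual` applies, and `du(dt v)`, which the
  -- conormal covector kills. As `ds du = id`, the splitting produces the term `-t*df`.
  have h0 : T (v - U (T v)) = 0 := by
    rw [map_sub]; exact sub_eq_zero_of_eq (ht (T v)).symm
  have h1 : C.κ x a (v - U (T v)) = df (S (v - U (T v))) :=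
    (C.anchor_dual f x _ h0).trans (DFunLike.congr_fun hdf _)
  have h2 : C.κ x a (U (T v)) = 0 := hu _
  have h3 : S (U (T v)) = T v := hs _
  rw [map_sub, h2, sub_zero, map_sub, h3, map_sub] at h1
  exact h1

/-- The bivector field `s_* π` on the base satisfies `π_M♯(df) = 𝐚(𝒟 f)`. -/
theorem Correspondence.anchor_𝒟fun (hΓ : IsHamQPGroupoid 𝒢 B ρ π Φ)
    (C : Correspondence 𝒢 ρ π Φ 𝒜) (f : Fn m M) (x : M) :
    (mfderiv (𝓡 n) (𝓡 m) 𝒢.s (𝒢.u x) (π.sharp (𝒢.u x) (pullCovector 𝒢.s (𝒢.u x) (dfun (n := m) f x))) :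
      EuclideanSpace ℝ (Fin m)) = 𝒜.anchorMap x (𝒜.𝒟fun f x) := by
  set a := ExteriorAlgebra.ιInv (𝒜.dDual (algebraMap (Fn m M) (MSec m r A) f)) x with ha
  let df : EuclideanSpace ℝ (Fin m) →L[ℝ] ℝ := dfun (n := m) f x
  let S : TangentSpace (𝓡 n) (𝒢.u x) →L[ℝ] EuclideanSpace ℝ (Fin m) :=
    mfderiv (𝓡 n) (𝓡 m) 𝒢.s (𝒢.u x)
  have h1 := C.anchor x a
  rw [C.κ_dDual] at h1
  have h2 : ρ.transpose (pullCovector 𝒢.s (𝒢.u x) (dfun (n := m) f x) -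
      pullCovector 𝒢.t (𝒢.u x) (dfun (n := m) f x)) = 0 :=
    sub_eq_zero_of_eq (transpose_target_unit hΓ.infAut x (dfun (n := m) f x)).symm
  rw [h2, map_zero, smul_zero, map_zero, add_zero, map_sub] at h1
  -- Apply `ds`, which inverts `du` on tangent vectors of the units.
  have h3 : (𝒜.anchorMap x a : EuclideanSpace ℝ (Fin m)) =
      S (π.sharp (𝒢.u x) (pullCovector 𝒢.s (𝒢.u x) (dfun (n := m) f x))) -
      S (π.sharp (𝒢.u x) (pullCovector 𝒢.t (𝒢.u x) (dfun (n := m) f x))) := by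
    rw [← map_sub, ← h1]
    exact (mfderiv_section 𝒢.smooth_s 𝒢.smooth_u 𝒢.s_unit x _).symm
  let R : GroupLieAlgebra (𝓡 k) G →ₗ[ℝ] EuclideanSpace ℝ (Fin m) :=
    (S : TangentSpace (𝓡 n) (𝒢.u x) →ₗ[ℝ] EuclideanSpace ℝ (Fin m)) ∘ₗ ρ.act (𝒢.u x)
  have hR : ∀ ξ, (𝒜.anchorMap x (𝒜.ρ ξ x) : EuclideanSpace ℝ (Fin m)) = R ξ :=
    fun ξ => (C.anchor_ρ hΓ ξ x).symm
  let aM : A x →ₗ[ℝ] EuclideanSpace ℝ (Fin m) := 𝒜.anchorMap x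
  have h4 : aM a = aM (𝒜.𝒟fun f x) +
      (2⁻¹ : ℝ) • ∑ i, df (R (B.lo i)) • R (B.up i) := by
    rw [ha, 𝒜.ιInv_dDual, map_add, map_smul, map_sum]
    refine congrArg₂ _ rfl (congrArg _ (Finset.sum_congr rfl fun i _ => ?_))
    rw [map_smul]
    exact congrArg₂ _ (congrArg df (hR _)) (hR _)
  -- Compare the two expressions `h3` and `h4` for the anchor of `d_{A*} f`: the mixed term, given
  -- by `target_source_unit`, cancels the sum over dual bases.
  have key : ∀ β : EuclideanSpace ℝ (Fin m) →L[ℝ] ℝ,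
      β (S (π.sharp (𝒢.u x) (pullCovector 𝒢.s (𝒢.u x) (dfun (n := m) f x)))) =
        β (𝒜.anchorMap x (𝒜.𝒟fun f x)) := by
    intro β
    have h5 := congrArg β (h3.symm.trans h4)
    have h6 : β (S (π.sharp (𝒢.u x) (pullCovector 𝒢.t (𝒢.u x) df))) = _ :=
      hΓ.fusion.target_source_unit hΓ.infAut x df β
    have h7 := B.sum_lo_mul_up (ρ.transpose (pullCovector 𝒢.s (𝒢.u x) df))
      (ρ.transpose (pullCovector 𝒢.s (𝒢.u x) β))
    rw [← h7] at h6
    have h8 : β (∑ i, df (R (B.lo i)) • R (B.up i)) =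
        ∑ i, ρ.transpose (pullCovector 𝒢.s (𝒢.u x) df) (B.lo i) *
          ρ.transpose (pullCovector 𝒢.s (𝒢.u x) β) (B.up i) := by
      rw [map_sum]
      exact Finset.sum_congr rfl fun i _ => map_smul β _ _
    have h9 : β (S (π.sharp (𝒢.u x) (pullCovector 𝒢.s (𝒢.u x) df))) -
        β (S (π.sharp (𝒢.u x) (pullCovector 𝒢.t (𝒢.u x) df))) =
        β (𝒜.anchorMap x (𝒜.𝒟fun f x)) + 2⁻¹ * β (∑ i, df (R (B.lo i)) • R (B.up i)) :=
      (map_sub β _ _).symm.trans (h5.trans ((map_add β _ _).trans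
        (congrArg₂ _ rfl (map_smul β _ _))))
    rw [h6, h8] at h9
    change β (S (π.sharp (𝒢.u x) (pullCovector 𝒢.s (𝒢.u x) df))) = _
    linarith
  exact PiLp.ext fun i => key (EuclideanSpace.proj i)

end Correspondence
end QP

/-! ### The proposition -/

theorem proposition1p25 {k m n r : ℕ}
  {G : Type*} [TopologicalSpace G] [ChartedSpace (EuclideanSpace ℝ (Fin k)) G]
  [Group G] [LieGroup (𝓡 k) ∞ G]
  {Γ M : Type*}
  [TopologicalSpace Γ] [ChartedSpace (EuclideanSpace ℝ (Fin n)) Γ] [IsManifold (𝓡 n) ∞ Γ]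
  [TopologicalSpace M] [ChartedSpace (EuclideanSpace ℝ (Fin m)) M] [IsManifold (𝓡 m) ∞ M]
  [T2Space M] [SigmaCompactSpace M]
  {A : M → Type*}
  [TopologicalSpace (Bundle.TotalSpace (EuclideanSpace ℝ (Fin r)) A)]
  [∀ x, TopologicalSpace (A x)] [∀ x, AddCommGroup (A x)] [∀ x, Module ℝ (A x)]
  [FiberBundle (EuclideanSpace ℝ (Fin r)) A] [VectorBundle ℝ (EuclideanSpace ℝ (Fin r)) A]
  [ContMDiffVectorBundle ∞ (EuclideanSpace ℝ (Fin r)) A (𝓡 m)]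
  (B : QP.InvForm (GroupLieAlgebra (𝓡 k) G)) (𝒢 : QP.LieGroupoid n m Γ M)
    (ρ : QP.GAction (GroupLieAlgebra (𝓡 k) G) n Γ) (π : QP.BivectorField n Γ) (Φ : Γ → G)
    (hΓ : QP.IsHamQPGroupoid 𝒢 B ρ π Φ)
    (𝒜 : QP.QPBialgebroid B m r A) (C : QP.Correspondence 𝒢 ρ π Φ 𝒜) :
  ∃ (ρM : QP.GAction (GroupLieAlgebra (𝓡 k) G) m M) (πD : QP.BivectorField m M),
    (∀ ξ x, ρM.act x ξ = 𝒜.anchorMap x (𝒜.ρ ξ x)) ∧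
    (∀ (f : QP.Fn m M) x, πD.sharp x (QP.dfun f x) = 𝒜.anchorMap x (𝒜.𝒟fun f x)) ∧
    QP.IsQuasiPoisson B ρM πD ∧
    QP.IsQPMap 𝒢.s ρ π ρM πD ∧
    QP.IsAntiQPMap 𝒢.t ρ π ρM πD := by
  have hact : ∀ ξ x, mfderiv (𝓡 m) (𝓡 n) 𝒢.u x
      (mfderiv (𝓡 n) (𝓡 m) 𝒢.s (𝒢.u x) (ρ.act (𝒢.u x) ξ)) = ρ.act (𝒢.u x) ξ :=
    fun ξ x => (hΓ.infAut ξ).mfderiv_u x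
  let ρM := ρ.restrict 𝒢.smooth_s 𝒢.smooth_u 𝒢.s_unit hact
  let πD := π.pushAlong 𝒢.s 𝒢.u 𝒢.smooth_s 𝒢.smooth_u 𝒢.s_unit
  have hs : QP.IsQPMap 𝒢.s ρ π ρM πD :=
    { smooth := 𝒢.smooth_s
      equivariant := fun g ξ => (hΓ.infAut ξ).mfderiv_s g
      -- Equality of vectors is tested on coordinate covectors. Since `πD` is defined through the
      -- unit over a point, this is `source_source`.
      bivector := fun g β => PiLp.ext fun i =>
        hΓ.fusion.source_source g β (EuclideanSpace.proj i) }
  have ht : QP.IsAntiQPMap 𝒢.t ρ π ρM πD :=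
    { smooth := 𝒢.smooth_t
      equivariant := fun g ξ => (hΓ.infAut ξ).mfderiv_t g
      -- Move from `g` to the unit of `t g`, and there exchange `t` for `s` at the cost of a sign.
      bivector := fun g β => PiLp.ext fun i =>
        (hΓ.fusion.target_target g β (EuclideanSpace.proj i)).trans
          (hΓ.fusion.target_target_unit hΓ.infAut _ β (EuclideanSpace.proj i)) }
  exact ⟨ρM, πD, fun ξ x => C.anchor_ρ hΓ ξ x, fun f x => C.anchor_𝒟fun hΓ f x,
    hs.isQuasiPoisson (fun x => ⟨𝒢.u x, 𝒢.s_unit x⟩) hΓ.quasiPoisson, hs, ht⟩
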